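/- **Setting.** Let $\mathcal P$ be a finite set of processes. A fail-prone system is a collection of subsets of $\mathcal P$, none contained in another; $\mathcal A^*$ denotes the collection of all subsets of members of $\mathcal A$. Let $\mathbb F=[\mathcal F_i]_{p_i\in\mathcal P}$ be an array of fail-prone systems and $\mathbb Q=[\mathcal Q_i]_{p_i\in\mathcal P}$ an asymmetric Byzantine quorum system for $\mathbb F$, i.e. $\mathcal Q_i\subseteq 2^{\mathcal P}$ and: (consistency) for all $i,j$, $Q_i\in\mathcal Q_i$, $Q_j\in\mathcal Q_j$, $F_{ij}\in\mathcal F_i^*\cap\mathcal F_j^*$ we have $Q_i\cap Q_j\not\subseteq F_{ij}$; (availability) for all $i$ and $F_i\in\mathcal F_i$ there is $Q_i\in\mathcal Q_i$ with $F_i\cap Q_i=\emptyset$. A core set for $p_i$ is a minimal set among the sets $C\subseteq\mathcal P$ that satisfy $C\not\subseteq F_i$ for all $F_i\in\mathcal F_i$; $\mathcal C_i$ is the collection of all core sets for $p_i$. In an execution with set $F$ of faulty processes, the other processes are correct, and $p_i$ is wise if it is correct and $F\in\mathcal F_i^*$. **System.** Processes communicate asynchronously over authenticated, reliable FIFO point-to-point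 links (a process also sends to itself when it sends to all). Faulty processes are Byzantine: they may send arbitrary messages, in their own name, at any time. Executions are fair: every message in transit to a correct process is eventually received, and a correct process does not wait forever for a condition that holds. One designated process $p_w$ may invoke $\mathit{write}(x)$, with $x$ in the domain $\mathcal X$; every process may invoke $\mathit{read}$; a correct process invokes an operation only when it has none pending. **Double-write protocol.** Every process $p_i$ stores a pre-written pair $(pts,pv)$ and a written pair $(ts,v)$, both initially $(0,x_0)$, where $x_0\in\mathcal X$ is the initial value of the register; $wts$ and $rid$ are initially $0$. * $\mathit{write}(x)$ at $p_w$: $wts\gets wts+1$; send $[\mathrm{PREWRITE},wts,x]$ to all; wait until the processes of some $Q_w\in\mathcal Q_w$ have answered this message with $[\mathrm{PREACK}]$; send $[\mathrm{WRITE},wts,x]$ to all; wait until the processes of some $Q_w\in\mathcal Q_w$ have answered this message with $[\mathrm{ACK}]$; the write completes. (The $t$-th $[\mathrm{PREACK}]$ or $[\mathrm{ACK}]$ received on a link counts as the answer to the $t$-th PREWRITE or WRITE, respectively.) * $\mathit{read}$ at $p_r$: $rid\gets rid+1$; start with an empty list $readlist$; send $[\mathrm{READ},rid]$ to all. While the read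 is pending, upon receiving $[\mathrm{VALUE},r_j,pts_j,pv_j,ts_j,v_j]$ from $p_j$ with $r_j=rid$ and ($pts_j=ts_j+1$ or $(pts_j,pv_j)=(ts_j,v_j)$): set $readlist[j]\gets(pts_j,pv_j,ts_j,v_j)$; if there are $(ts^*,v^*)$, $C_r\in\mathcal C_r$ and $Q_r\in\mathcal Q_r$ such that every $p_k\in C_r$ has an entry $readlist[k]=(pts_k,pv_k,ts_k,v_k)$ with $(pts_k,pv_k)=(ts^*,v^*)$ or $(ts_k,v_k)=(ts^*,v^*)$, and every $p_k\in Q_r$ has an entry with $ts_k<ts^*$ or $(pts_k,pv_k)=(ts^*,v^*)$ or $(ts_k,v_k)=(ts^*,v^*)$, then the read returns $v^*$ for some such pair and completes; otherwise send $[\mathrm{READ},rid]$ to all. * Every process, upon receiving $[\mathrm{PREWRITE},t,x]$ from $p_w$ with $t=pts+1$ and $pts=ts$: $(pts,pv)\gets(t,x)$, send $[\mathrm{PREACK}]$ to $p_w$. Upon receiving $[\mathrm{WRITE},t,x]$ from $p_w$ with $t=pts$ and $x=pv$: $(ts,v)\gets(t,x)$, send $[\mathrm{ACK}]$ to $p_w$.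 Upon receiving $[\mathrm{READ},r]$ from $p_r$: send $[\mathrm{VALUE},r,pts,pv,ts,v]$ to $p_r$. Messages that do not satisfy the stated conditions on receipt are ignored. **Theorem.** This protocol emulates an asymmetric Byzantine SWMR regular register for wise readers and writer, provided there are only finitely many write operations. That is, in every fair execution, with any set $F$ of faulty processes for which $p_w$ is wise and with only finitely many write invocations: * (Liveness) every operation invoked by a wise process eventually completes. * (Safety) every completed read of a wise process returns the value of the most recent write of a wise process that completes before the read is invoked ($x_0$ if there is none), or the value of a write of a wise process that is concurrent with the read; in particular it returns the former value if no write is concurrent with it. (Two operations are concurrent if neither completes before the other is invoked.) -/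

import Mathlib

namespace AsymRegister

/-! ### Asymmetric trust: fail-prone systems, quorums, core sets, wise processes -/

/-- A fail-prone system: a collection of sets of processes, none contained in another. -/
def IsFailProneSystem {P : Type*} (𝓕 : Set (Set P)) : Prop :=
  ∀ A ∈ 𝓕, ∀ B ∈ 𝓕, A ⊆ B → A = B

/-- The collection `𝓐^*` of all subsets of the sets in `𝓐`. -/
def downClosure {P : Type*} (𝓐 : Set (Set P)) : Set (Set P) :=
  {A' | ∃ A ∈ 𝓐, A' ⊆ A}

/-- `𝓠 i` is the quorum system of process `i`; `𝓕 i` is its fail-prone system. -/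
structure IsAsymQuorumSystem {P : Type*} (𝓕 𝓠 : P → Set (Set P)) : Prop where
  consistency : ∀ i j, ∀ Qi ∈ 𝓠 i, ∀ Qj ∈ 𝓠 j,
    ∀ Fij ∈ downClosure (𝓕 i) ∩ downClosure (𝓕 j), ¬ (Qi ∩ Qj ⊆ Fij)
  availability : ∀ i, ∀ Fi ∈ 𝓕 i, ∃ Qi ∈ 𝓠 i, Fi ∩ Qi = ∅

/-- The core set system of a fail-prone system: all sets that are not contained in a fail-prone
set and are minimal in this respect. -/
def coreSets {P : Type*} (𝓕 : Set (Set P)) : Set (Set P) :=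
  {C | (∀ A ∈ 𝓕, ¬ C ⊆ A) ∧ ∀ C', C' ⊂ C → ∃ A ∈ 𝓕, C' ⊆ A}

/-- The wise processes when `F` is the set of faulty processes: correct processes whose trust
assumption foresees `F`. -/
def wise {P : Type*} (𝓕 : P → Set (Set P)) (F : Set P) : Set P :=
  {p | p ∉ F ∧ F ∈ downClosure (𝓕 p)}

/-! ### Histories of a register and the regular register specification -/

/-- Invocations and responses of register operations with domain `X`. -/
inductive RegEvent (X : Type*)
  | writeInv (x : X)
  | writeAck
  | readInv
  | readRet (x : X)

/-- A history in discrete time: at each time at most one register event occurs, at one process. -/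
abbrev History (P X : Type*) := ℕ → Option (P × RegEvent X)

namespace History

variable {P X : Type*} (h : History P X)

/-- `e` occurs at process `p` at time `m`, and is the first event at `p` after time `n`. -/
def NextEvent (p : P) (n m : ℕ) (e : RegEvent X) : Prop :=
  n < m ∧ h m = some (p, e) ∧ ∀ k, n < k → k < m → ∀ e', h k ≠ some (p, e')

/-- A write of `x` by a process of the set `W` is invoked at time `a`. -/
def IsWrite (W : Set P) (a : ℕ) (x : X) : Prop :=
  ∃ q ∈ W, h a = some (q, .writeInv x)

/-- The write invoked at time `a` completes at time `b`. -/
def WriteCompletes (a b : ℕ) : Prop :=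
  ∃ q x, h a = some (q, .writeInv x) ∧ h.NextEvent q a b .writeAck

/-- The read invoked by `p` at time `n` completes at time `m`, returning `x`. -/
def ReadCompletes (p : P) (n m : ℕ) (x : X) : Prop :=
  h n = some (p, .readInv) ∧ h.NextEvent p n m (.readRet x)

/-- The write invoked at time `a` completes before time `n`. -/
def WritePrecedes (a n : ℕ) : Prop := ∃ b, h.WriteCompletes a b ∧ b < n

/-- The write invoked at time `a` is concurrent with the read invoked at time `n` and completed
at time `m`: neither one completes before the other one is invoked. -/
def WriteConcurrent (a n m : ℕ) : Prop := ¬ h.WritePrecedes a n ∧ ¬ m < a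

/-- `x` is the value written by the most recent write (of a process in `W`) that completes before
time `n`, where an imaginary initial write of `x₀` precedes everything. -/
def LastWritten (W : Set P) (x₀ : X) (n : ℕ) (x : X) : Prop :=
  (∃ a, h.IsWrite W a x ∧ h.WritePrecedes a n ∧
    ∀ a' x', h.IsWrite W a' x' → h.WritePrecedes a' n → a' ≤ a) ∨
  (x = x₀ ∧ ∀ a' x', h.IsWrite W a' x' → ¬ h.WritePrecedes a' n)

/-- The asymmetric SWMR regular register, `W` being the set of wise processes. -/
structure IsRegularRegister (W : Set P) (x₀ : X) : Prop where
  write_liveness : ∀ p ∈ W, ∀ n x, h n = some (p, .writeInv x) →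
    ∃ m, h.NextEvent p n m .writeAck
  read_liveness : ∀ p ∈ W, ∀ n, h n = some (p, .readInv) →
    ∃ m x, h.NextEvent p n m (.readRet x)
  safety : ∀ p ∈ W, ∀ n m x, h.ReadCompletes p n m x →
    h.LastWritten W x₀ n x ∨ ∃ a, h.IsWrite W a x ∧ h.WriteConcurrent a n m

/-- Only finitely many writes are invoked. -/
def FinitelyManyWrites : Prop :=
  {n : ℕ | ∃ p x, h n = some (p, .writeInv x)}.Finite

end History

/-! ### The double-write protocol -/

/-- Protocol messages. -/
inductive Msg (X : Type*)
  | prewrite (t : ℕ) (x : X)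
  | preack
  | write (t : ℕ) (x : X)
  | ack
  | read (r : ℕ)
  | value (r pts : ℕ) (pv : X) (ts : ℕ) (v : X)

/-- What a process is currently executing: nothing, a write that waits for `preack` messages,
a write that waits for `ack` messages, or a read. -/
inductive Phase (X : Type*)
  | idle
  | prewriting (x : X)
  | writing (x : X)
  | reading

/-- The last accepted reply of a process to a read. -/
structure Entry (X : Type*) where
  pts : ℕ
  pv : X
  ts : ℕ
  v : X

/-- The local state of a process. `preacks j` and `acks j` count the `preack` and `ack` messages
received from `j`; as links are FIFO, the `t`-th of them answers the `t`-th request to `j`. -/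
structure LocalState (P X : Type*) where
  phase : Phase X
  wts : ℕ
  preacks : P → ℕ
  acks : P → ℕ
  rid : ℕ
  readlist : P → Option (Entry X)
  pts : ℕ
  pv : X
  ts : ℕ
  v : X

/-- Initial local state; `x₀` is the initial value of the register, with timestamp `0`. -/
def LocalState.init (P : Type*) {X : Type*} (x₀ : X) : LocalState P X where
  phase := .idle
  wts := 0
  preacks := fun _ => 0
  acks := fun _ => 0
  rid := 0
  readlist := fun _ => none
  pts := 0
  pv := x₀
  ts := 0
  v := x₀

/-- The entry carries the pair `(t, x)` as its pre-written or as its written pair. -/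
def Entry.Carries {X : Type*} (e : Entry X) (t : ℕ) (x : X) : Prop :=
  (e.pts, e.pv) = (t, x) ∨ (e.ts, e.v) = (t, x)

/-- The return condition of reader `r` for the timestamp/value pair `(t, x)`. -/
def Selects {P X : Type*} (𝓕 𝓠 : P → Set (Set P)) (r : P) (readlist : P → Option (Entry X))
    (t : ℕ) (x : X) : Prop :=
  (∃ C ∈ coreSets (𝓕 r), C ⊆ {k | ∃ e, readlist k = some e ∧ e.Carries t x}) ∧
  (∃ Q ∈ 𝓠 r, Q ⊆ {k | ∃ e, readlist k = some e ∧ (e.ts < t ∨ e.Carries t x)})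

/-- The messages that a step sends, listed by destination. -/
abbrev Outbox (P X : Type*) := P → List (Msg X)

/-- Send nothing. -/
def Outbox.silent {P X : Type*} : Outbox P X := fun _ => []

/-- Send `m` to all processes (the sender included). -/
def Outbox.toAll {P X : Type*} (m : Msg X) : Outbox P X := fun _ => [m]

/-- Send `m` to `j`. -/
def Outbox.to {P X : Type*} [DecidableEq P] (j : P) (m : Msg X) : Outbox P X :=
  fun k => if k = j then [m] else []

/-- The condition under which a reader in state `s` accepts a `value` message. -/
def AcceptsValue {P X : Type*} (s : LocalState P X) (r : ℕ) (e : Entry X) : Prop :=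
  s.phase = .reading ∧ r = s.rid ∧ (e.pts = e.ts + 1 ∨ (e.pts, e.pv) = (e.ts, e.v))

/-- `Receive 𝓕 𝓠 w i j s m s' out res`: correct process `i` in state `s` receives message `m` from
`j`, moves to state `s'` and sends `out`; `res = some x` if its pending read returns `x`. The writer
is `w`. -/
inductive Receive {P X : Type*} [DecidableEq P] (𝓕 𝓠 : P → Set (Set P)) (w i j : P)
    (s : LocalState P X) : Msg X → LocalState P X → Outbox P X → Option X → Prop
  | prewrite (t : ℕ) (x : X) (hg : j = w ∧ t = s.pts + 1 ∧ s.pts = s.ts) :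
      Receive 𝓕 𝓠 w i j s (.prewrite t x) { s with pts := t, pv := x } (.to w .preack) none
  | prewriteIgnored (t : ℕ) (x : X) (hg : ¬ (j = w ∧ t = s.pts + 1 ∧ s.pts = s.ts)) :
      Receive 𝓕 𝓠 w i j s (.prewrite t x) s .silent none
  | write (t : ℕ) (x : X) (hg : j = w ∧ t = s.pts ∧ x = s.pv) :
      Receive 𝓕 𝓠 w i j s (.write t x) { s with ts := t, v := x } (.to w .ack) none
  | writeIgnored (t : ℕ) (x : X) (hg : ¬ (j = w ∧ t = s.pts ∧ x = s.pv)) :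
      Receive 𝓕 𝓠 w i j s (.write t x) s .silent none
  | preack :
      Receive 𝓕 𝓠 w i j s .preack
        { s with preacks := Function.update s.preacks j (s.preacks j + 1) } .silent none
  | ack :
      Receive 𝓕 𝓠 w i j s .ack
        { s with acks := Function.update s.acks j (s.acks j + 1) } .silent none
  | read (r : ℕ) :
      Receive 𝓕 𝓠 w i j s (.read r) s (.to j (.value r s.pts s.pv s.ts s.v)) none
  | valueReturn (r pts : ℕ) (pv : X) (ts : ℕ) (v : X) (t : ℕ) (x : X)
      (hg : AcceptsValue s r ⟨pts, pv, ts, v⟩)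
      (hsel : Selects 𝓕 𝓠 i (Function.update s.readlist j (some ⟨pts, pv, ts, v⟩)) t x) :
      Receive 𝓕 𝓠 w i j s (.value r pts pv ts v)
        { s with
          readlist := Function.update s.readlist j (some ⟨pts, pv, ts, v⟩)
          phase := .idle } .silent (some x)
  | valueRetry (r pts : ℕ) (pv : X) (ts : ℕ) (v : X)
      (hg : AcceptsValue s r ⟨pts, pv, ts, v⟩)
      (hsel : ∀ t x,
        ¬ Selects 𝓕 𝓠 i (Function.update s.readlist j (some ⟨pts, pv, ts, v⟩)) t x) :
      Receive 𝓕 𝓠 w i j s (.value r pts pv ts v)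
        { s with readlist := Function.update s.readlist j (some ⟨pts, pv, ts, v⟩) }
        (.toAll (.read s.rid)) none
  | valueIgnored (r pts : ℕ) (pv : X) (ts : ℕ) (v : X)
      (hg : ¬ AcceptsValue s r ⟨pts, pv, ts, v⟩) :
      Receive 𝓕 𝓠 w i j s (.value r pts pv ts v) s .silent none

/-! ### Executions of the protocol with Byzantine processes -/

/-- Global state: local states, and the FIFO queue `chan j i` of messages in transit from `j`
to `i` (oldest message first). -/
structure GlobalState (P X : Type*) where
  proc : P → LocalState P X
  chan : P → P → List (Msg X)

/-- The initial state: every process in its initial state, no message in transit. -/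
def GlobalState.init (P : Type*) {X : Type*} (x₀ : X) : GlobalState P X where
  proc := fun _ => LocalState.init P x₀
  chan := fun _ _ => []

/-- Replace the queue from `j` to `i`. -/
def GlobalState.setChan {P X : Type*} [DecidableEq P] (g : GlobalState P X) (j i : P)
    (q : List (Msg X)) : GlobalState P X :=
  { g with chan := Function.update g.chan j (Function.update (g.chan j) i q) }

/-- Process `i` moves to local state `s` and sends the messages in `out`. -/
def GlobalState.act {P X : Type*} [DecidableEq P] (g : GlobalState P X) (i : P)
    (s : LocalState P X) (out : Outbox P X) : GlobalState P X where
  proc := Function.update g.proc i s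
  chan := Function.update g.chan i (fun k => g.chan i k ++ out k)

/-- The kinds of steps. `deliver j i res` is the receipt by `i` of the oldest message in transit
from `j`; `res = some x` if this makes the pending read of `i` return `x`. `byzSend i j m` is the
sending of an arbitrary message by a faulty process. -/
inductive Label (P X : Type*)
  | stutter
  | invokeWrite (x : X)
  | prewriteDone
  | writeDone
  | invokeRead (i : P)
  | deliver (j i : P) (res : Option X)
  | byzSend (i j : P) (m : Msg X)

/-- In state `s`, the writer `w` waits for `preack` messages, and all processes in some quorum for
`w` have answered the current `prewrite` message. -/
def PreackQuorum {P X : Type*} (𝓠 : P → Set (Set P)) (w : P) (s : LocalState P X) : Prop :=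
  (∃ x, s.phase = .prewriting x) ∧ ∃ Q ∈ 𝓠 w, ∀ j ∈ Q, s.wts ≤ s.preacks j

/-- In state `s`, the writer `w` waits for `ack` messages, and all processes in some quorum for
`w` have answered the current `write` message. -/
def AckQuorum {P X : Type*} (𝓠 : P → Set (Set P)) (w : P) (s : LocalState P X) : Prop :=
  (∃ x, s.phase = .writing x) ∧ ∃ Q ∈ 𝓠 w, ∀ j ∈ Q, s.wts ≤ s.acks j

/-- The steps of the system in which `w` is the writer and `F` the set of faulty processes. Correct
processes follow the protocol and invoke an operation only when no operation of theirs is pending;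
only the writer writes; faulty processes may send anything at any time, in their own name. -/
inductive Step {P X : Type*} [DecidableEq P] (𝓕 𝓠 : P → Set (Set P)) (w : P) (F : Set P)
    (g : GlobalState P X) : Label P X → GlobalState P X → Prop
  | stutter : Step 𝓕 𝓠 w F g .stutter g
  | invokeWrite (x : X) (hw : w ∉ F) (hph : (g.proc w).phase = .idle) :
      Step 𝓕 𝓠 w F g (.invokeWrite x)
        (g.act w { g.proc w with wts := (g.proc w).wts + 1, phase := .prewriting x }
          (.toAll (.prewrite ((g.proc w).wts + 1) x)))
  | prewriteDone (x : X) (hw : w ∉ F) (hph : (g.proc w).phase = .prewriting x)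
      (hq : PreackQuorum 𝓠 w (g.proc w)) :
      Step 𝓕 𝓠 w F g .prewriteDone
        (g.act w { g.proc w with phase := .writing x } (.toAll (.write (g.proc w).wts x)))
  | writeDone (hw : w ∉ F) (hq : AckQuorum 𝓠 w (g.proc w)) :
      Step 𝓕 𝓠 w F g .writeDone (g.act w { g.proc w with phase := .idle } .silent)
  | invokeRead (i : P) (hi : i ∉ F) (hph : (g.proc i).phase = .idle) :
      Step 𝓕 𝓠 w F g (.invokeRead i)
        (g.act i
          { g.proc i with
            rid := (g.proc i).rid + 1
            readlist := fun _ => none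
            phase := .reading }
          (.toAll (.read ((g.proc i).rid + 1))))
  | deliver (j i : P) (m : Msg X) (rest : List (Msg X)) (s' : LocalState P X) (out : Outbox P X)
      (res : Option X) (hi : i ∉ F) (hm : g.chan j i = m :: rest)
      (hr : Receive 𝓕 𝓠 w i j (g.proc i) m s' out res) :
      Step 𝓕 𝓠 w F g (.deliver j i res) ((g.setChan j i rest).act i s' out)
  | deliverFaulty (j i : P) (m : Msg X) (rest : List (Msg X)) (hi : i ∈ F)
      (hm : g.chan j i = m :: rest) :
      Step 𝓕 𝓠 w F g (.deliver j i none) (g.setChan j i rest)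
  | byzSend (i j : P) (m : Msg X) (hi : i ∈ F) :
      Step 𝓕 𝓠 w F g (.byzSend i j m) (g.setChan i j (g.chan i j ++ [m]))

/-- The register event, if any, that a step represents. -/
def Label.event {P X : Type*} (w : P) : Label P X → Option (P × RegEvent X)
  | .invokeWrite x => some (w, .writeInv x)
  | .writeDone => some (w, .writeAck)
  | .invokeRead i => some (i, .readInv)
  | .deliver _ i (some x) => some (i, .readRet x)
  | _ => none

/-- An infinite execution of the protocol (possibly stuttering): step `n` is labelled `step n` and
leads from `state n` to `state (n + 1)`. -/
structure Execution {P X : Type*} [DecidableEq P] (𝓕 𝓠 : P → Set (Set P)) (w : P) (x₀ : X)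
    (F : Set P) where
  state : ℕ → GlobalState P X
  step : ℕ → Label P X
  init : state 0 = GlobalState.init P x₀
  next : ∀ n, Step 𝓕 𝓠 w F (state n) (step n) (state (n + 1))

namespace Execution

variable {P X : Type*} [DecidableEq P] {𝓕 𝓠 : P → Set (Set P)} {w : P} {x₀ : X} {F : Set P}

/-- Fairness: every message in transit to a correct process is eventually received, and a correct
writer does not wait forever once the condition that it waits for holds. -/
structure Fair (σ : Execution 𝓕 𝓠 w x₀ F) : Prop where
  delivery : ∀ j i, i ∉ F → ∀ n, (∀ m, n ≤ m → (σ.state m).chan j i ≠ []) →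
    ∃ m, n ≤ m ∧ ∃ res, σ.step m = .deliver j i res
  prewriteDone : w ∉ F → ∀ n, (∀ m, n ≤ m → PreackQuorum 𝓠 w ((σ.state m).proc w)) →
    ∃ m, n ≤ m ∧ σ.step m = .prewriteDone
  writeDone : w ∉ F → ∀ n, (∀ m, n ≤ m → AckQuorum 𝓠 w ((σ.state m).proc w)) →
    ∃ m, n ≤ m ∧ σ.step m = .writeDone

/-- The history of an execution. -/
def history (σ : Execution 𝓕 𝓠 w x₀ F) : History P X := fun n => (σ.step n).event w

end Execution

end AsymRegister

/-!
FIFO links make the state of a correct replica a function of the number of messages of the writer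
that it has processed: `prewrite` and `write` alternate, so after `c` of them the pre-written pair
is the `(c + 1) / 2`-th one and the written pair the `c / 2`-th one (`replicaEntry`).

Safety. A completed write has been acknowledged by a quorum of the writer. The quorum of the reader
meets it in a correct process, whose reply was sent after the read was invoked, since it carries the
identifier of that read; hence the returned timestamp is at least that of every write that precedes
the read. A core set of the reader contains a correct process, so the returned pair really is a pair
of the writer.

Liveness. A write waits only for the answers of a quorum of correct processes. Once the finitely
many writes are over, all correct replicas settle on the same pair. A pending read polls again after
every reply, so a read that never returned would collect that pair from a correct quorum; since that
quorum contains a core set, the read would return.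
-/

namespace AsymRegister

section Trust

variable {P : Type*} {𝓕 𝓠 : P → Set (Set P)} {F : Set P}

theorem exists_coreSet_subset {𝓐 : Set (Set P)} {S : Set P} (hfin : S.Finite)
    (hS : ∀ A ∈ 𝓐, ¬ S ⊆ A) : ∃ C ∈ coreSets 𝓐, C ⊆ S := by
  have hfin' : {C | C ⊆ S ∧ ∀ A ∈ 𝓐, ¬ C ⊆ A}.Finite := hfin.powerset.subset fun _ hC => hC.1
  obtain ⟨C, ⟨hCS, hC⟩, hmin⟩ := hfin'.exists_minimal ⟨S, subset_rfl, hS⟩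
  refine ⟨C, ⟨hC, fun C' hC' => ?_⟩, hCS⟩
  by_contra! h
  exact hC'.2 (hmin ⟨hC'.1.trans hCS, h⟩ hC'.1)

theorem exists_mem_coreSet_notMem {p : P} (hp : p ∈ wise 𝓕 F) {C : Set P}
    (hC : C ∈ coreSets (𝓕 p)) : ∃ k ∈ C, k ∉ F := by
  obtain ⟨A, hA, hFA⟩ := hp.2
  exact Set.not_subset.1 fun hCF => hC.1 A hA (hCF.trans hFA)

theorem IsAsymQuorumSystem.exists_quorum_subset_compl (h𝓠 : IsAsymQuorumSystem 𝓕 𝓠) {p : P}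
    (hp : p ∈ wise 𝓕 F) : ∃ Q ∈ 𝓠 p, Q ⊆ Fᶜ := by
  obtain ⟨A, hA, hFA⟩ := hp.2
  obtain ⟨Q, hQ, hAQ⟩ := h𝓠.availability p A hA
  exact ⟨Q, hQ, ((Set.disjoint_iff_inter_eq_empty.2 hAQ).mono_left hFA).subset_compl_left⟩

theorem IsAsymQuorumSystem.exists_mem_inter_notMem (h𝓠 : IsAsymQuorumSystem 𝓕 𝓠) {p q : P}
    (hp : p ∈ wise 𝓕 F) (hq : q ∈ wise 𝓕 F) {Q Q' : Set P} (hQ : Q ∈ 𝓠 p) (hQ' : Q' ∈ 𝓠 q) :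
    ∃ k ∈ Q ∩ Q', k ∉ F :=
  Set.not_subset.1 (h𝓠.consistency p q Q hQ Q' hQ' F ⟨hp.2, hq.2⟩)

theorem IsAsymQuorumSystem.exists_coreSet_subset_quorum (h𝓠 : IsAsymQuorumSystem 𝓕 𝓠) {p : P}
    {Q : Set P} (hQ : Q ∈ 𝓠 p) (hfin : Q.Finite) : ∃ C ∈ coreSets (𝓕 p), C ⊆ Q := by
  refine exists_coreSet_subset hfin fun A hA hQA => ?_
  have hA' : A ∈ downClosure (𝓕 p) := ⟨A, hA, subset_rfl⟩
  exact h𝓠.consistency p p Q hQ Q hQ A ⟨hA', hA'⟩ (Set.inter_subset_left.trans hQA)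

theorem IsAsymQuorumSystem.selects_of_forall_mem_quorum {X : Type*}
    (h𝓠 : IsAsymQuorumSystem 𝓕 𝓠) {p : P} {Q : Set P} (hQ : Q ∈ 𝓠 p) (hfin : Q.Finite)
    {readlist : P → Option (Entry X)} {e : Entry X} (hlist : ∀ k ∈ Q, readlist k = some e) :
    Selects 𝓕 𝓠 p readlist e.ts e.v := by
  obtain ⟨C, hC, hCQ⟩ := h𝓠.exists_coreSet_subset_quorum hQ hfin
  exact ⟨⟨C, hC, fun k hk => ⟨e, hlist k (hCQ hk), .inr rfl⟩⟩,
    ⟨Q, hQ, fun k hk => ⟨e, hlist k hk, .inr (.inr rfl)⟩⟩⟩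

end Trust

theorem History.exists_nextEvent {P X : Type*} {h : History P X} {p : P} {n m : ℕ}
    {e : RegEvent X} (hnm : n < m) (he : h m = some (p, e)) : ∃ b e', h.NextEvent p n b e' := by
  classical
  have hex : ∃ b, n < b ∧ ∃ e', h b = some (p, e') := ⟨m, hnm, e, he⟩
  obtain ⟨hb, e', he'⟩ := Nat.find_spec hex
  exact ⟨Nat.find hex, e', hb, he', fun k hk hkb e'' hk' => Nat.find_min hex hkb ⟨hk, e'', hk'⟩⟩

theorem exists_append_eq_of_succ {α : Type*} {f g : ℕ → List α}
    (hfg : ∀ n, f (n + 1) = f n ++ g n) {n m : ℕ} (hnm : n ≤ m) :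
    ∃ l, f m = f n ++ l ∧ ∀ x ∈ l, ∃ k, n ≤ k ∧ k < m ∧ x ∈ g k := by
  induction m, hnm using Nat.le_induction with
  | base => exact ⟨[], by simp⟩
  | succ m hnm ih =>
    obtain ⟨l, hl, hlg⟩ := ih
    refine ⟨l ++ g m, by rw [hfg, hl, List.append_assoc], fun x hx => ?_⟩
    rcases List.mem_append.1 hx with hx | hx
    · obtain ⟨k, hnk, hkm, hxk⟩ := hlg x hx
      exact ⟨k, hnk, by omega, hxk⟩
    · exact ⟨m, hnm, by omega, hx⟩

section LocalStep

variable {P X : Type*}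

/-- The process whose local state or outgoing links a step may change; `w` is the writer. -/
def Label.actor (w : P) : Label P X → Option P
  | .stutter => none
  | .invokeWrite _ | .prewriteDone | .writeDone => some w
  | .invokeRead i | .deliver _ i _ | .byzSend i _ _ => some i

theorem Label.actor_of_event {w i : P} {l : Label P X} {e : RegEvent X}
    (h : l.event w = some (i, e)) : l.actor w = some i := by
  rcases l with _ | _ | _ | _ | _ | ⟨j, k, _ | x⟩ | _ <;> simp_all [Label.event, Label.actor]

variable [DecidableEq P] {𝓕 𝓠 : P → Set (Set P)} {w i : P} {F : Set P}

/-- The messages that `i` receives from each process in a step with label `l` from `g`. -/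
def GlobalState.inbox (g : GlobalState P X) (l : Label P X) (i j : P) : List (Msg X) :=
  match l with
  | .deliver j' i' _ => if j' = j ∧ i' = i then (g.chan j i).take 1 else []
  | _ => []

theorem GlobalState.inbox_prefix_chan (g : GlobalState P X) (l : Label P X) (i j : P) :
    g.inbox l i j <+: g.chan j i := by
  unfold GlobalState.inbox
  split
  · split_ifs
    · exact List.take_prefix _ _
    · exact List.nil_prefix
  · exact List.nil_prefix

theorem GlobalState.inbox_eq_singleton {g : GlobalState P X} {l : Label P X} {j : P} {x : Msg X}
    (hx : x ∈ g.inbox l i j) : g.inbox l i j = [x] := by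
  unfold GlobalState.inbox at hx ⊢
  split at hx
  · split_ifs at hx ⊢
    · cases hc : g.chan j i <;> simp_all
    · cases hx
  · cases hx

/-- A step of the system as seen by the correct process `i`: in state `s`, it receives the messages
`inp j` from each process `j`, moves to state `s'` and sends `out`. -/
inductive LocalStep (𝓕 𝓠 : P → Set (Set P)) (w i : P) (s : LocalState P X) :
    Label P X → (P → List (Msg X)) → LocalState P X → Outbox P X → Prop
  | skip (l : Label P X) (hl : l.actor w ≠ some i) :
      LocalStep 𝓕 𝓠 w i s l (fun _ => []) s .silent
  | invokeWrite (x : X) (hi : i = w) (hph : s.phase = .idle) :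
      LocalStep 𝓕 𝓠 w i s (.invokeWrite x) (fun _ => [])
        { s with wts := s.wts + 1, phase := .prewriting x } (.toAll (.prewrite (s.wts + 1) x))
  | prewriteDone (x : X) (hi : i = w) (hph : s.phase = .prewriting x) :
      LocalStep 𝓕 𝓠 w i s .prewriteDone (fun _ => [])
        { s with phase := .writing x } (.toAll (.write s.wts x))
  | writeDone (hi : i = w) (hq : AckQuorum 𝓠 w s) :
      LocalStep 𝓕 𝓠 w i s .writeDone (fun _ => []) { s with phase := .idle } .silent
  | invokeRead (hph : s.phase = .idle) :
      LocalStep 𝓕 𝓠 w i s (.invokeRead i) (fun _ => [])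
        { s with rid := s.rid + 1, readlist := fun _ => none, phase := .reading }
        (.toAll (.read (s.rid + 1)))
  | receive (j : P) (m : Msg X) (s' : LocalState P X) (out : Outbox P X) (res : Option X)
      (hr : Receive 𝓕 𝓠 w i j s m s' out res) :
      LocalStep 𝓕 𝓠 w i s (.deliver j i res) (fun k => if k = j then [m] else []) s' out

theorem GlobalState.act_proc (g : GlobalState P X) (i k : P) (s : LocalState P X)
    (out : Outbox P X) : (g.act i s out).proc k = if k = i then s else g.proc k := by
  simp only [GlobalState.act, Function.update_apply]

theorem GlobalState.act_chan (g : GlobalState P X) (i j k : P) (s : LocalState P X)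
    (out : Outbox P X) :
    (g.act i s out).chan j k = g.chan j k ++ if j = i then out k else [] := by
  by_cases h : j = i
  · simp [GlobalState.act, h]
  · simp [GlobalState.act, h]

theorem GlobalState.setChan_chan (g : GlobalState P X) (j i a b : P) (q : List (Msg X)) :
    (g.setChan j i q).chan a b = if j = a ∧ i = b then q else g.chan a b := by
  by_cases ha : j = a
  · subst ha
    by_cases hb : i = b
    · simp [GlobalState.setChan, hb]
    · simp [GlobalState.setChan, hb, Ne.symm hb]
  · simp [GlobalState.setChan, ha, Ne.symm ha]

theorem GlobalState.inbox_append_setChan (g : GlobalState P X) {j i : P} {res : Option X}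
    {m : Msg X} {rest : List (Msg X)} (hm : g.chan j i = m :: rest) (a b : P) :
    g.inbox (.deliver j i res) b a ++ (g.setChan j i rest).chan a b = g.chan a b := by
  rw [GlobalState.setChan_chan, GlobalState.inbox]
  split_ifs with h
  · obtain ⟨rfl, rfl⟩ := h
    simp [hm]
  · rfl

theorem GlobalState.inbox_append_act (g : GlobalState P X) {l : Label P X}
    (hl : ∀ j i res, l ≠ .deliver j i res) (s : LocalState P X) (out : Outbox P X) (k : P) :
    g.inbox l k i ++ (g.act i s out).chan i k = g.chan i k ++ out k := by
  rw [GlobalState.act_chan, if_pos rfl, GlobalState.inbox]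
  · exact List.nil_append _
  · exact hl

theorem Step.exists_localStep_of_actor {g g' : GlobalState P X} {l : Label P X}
    (h : Step 𝓕 𝓠 w F g l g') (hi : i ∉ F) (hl : l.actor w = some i) :
    ∃ out, LocalStep 𝓕 𝓠 w i (g.proc i) l (g.inbox l i) (g'.proc i) out ∧
      ∀ k, g.inbox l k i ++ g'.chan i k = g.chan i k ++ out k := by
  cases h with
  | stutter => cases hl
  | byzSend j => exact absurd (Option.some.inj hl ▸ ‹j ∈ F›) hi
  | deliverFaulty j k => exact absurd (Option.some.inj hl ▸ ‹k ∈ F›) hi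
  | deliver j k m rest s' out res hk hm hr =>
    obtain rfl : k = i := Option.some.inj hl
    have hin : g.inbox (.deliver j k res) k = fun a => if a = j then [m] else [] := by
      funext a
      by_cases ha : a = j
      · simp [GlobalState.inbox, ha, hm]
      · simp [GlobalState.inbox, ha, Ne.symm ha]
    refine ⟨out, ?_, fun a => ?_⟩
    · rw [hin, GlobalState.act_proc, if_pos rfl]
      exact .receive j m s' out res hr
    · rw [GlobalState.act_chan, if_pos rfl, ← List.append_assoc, g.inbox_append_setChan hm]
  | invokeWrite x _ hph =>
    obtain rfl := Option.some.inj hl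
    refine ⟨_, ?_, g.inbox_append_act (by simp) _ _⟩
    rw [GlobalState.act_proc, if_pos rfl]
    exact .invokeWrite x rfl hph
  | prewriteDone x _ hph =>
    obtain rfl := Option.some.inj hl
    refine ⟨_, ?_, g.inbox_append_act (by simp) _ _⟩
    rw [GlobalState.act_proc, if_pos rfl]
    exact .prewriteDone x rfl hph
  | writeDone _ hq =>
    obtain rfl := Option.some.inj hl
    refine ⟨_, ?_, g.inbox_append_act (by simp) _ _⟩
    rw [GlobalState.act_proc, if_pos rfl]
    exact .writeDone rfl hq
  | invokeRead _ _ hph =>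
    obtain rfl := Option.some.inj hl
    refine ⟨_, ?_, g.inbox_append_act (by simp) _ _⟩
    rw [GlobalState.act_proc, if_pos rfl]
    exact .invokeRead hph

theorem GlobalState.inbox_eq_nil (g : GlobalState P X) {l : Label P X}
    (hl : l.actor w ≠ some i) (j : P) : g.inbox l i j = [] := by
  unfold GlobalState.inbox
  split
  · exact if_neg fun h => hl (congrArg some h.2)
  · rfl

theorem Step.proc_eq_of_actor_ne {g g' : GlobalState P X} {l : Label P X}
    (h : Step 𝓕 𝓠 w F g l g') (hl : l.actor w ≠ some i) : g'.proc i = g.proc i := by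
  have hne : ∀ {a}, l.actor w = some a → i ≠ a := fun ha hia => hl (hia ▸ ha)
  cases h with
  | stutter | deliverFaulty | byzSend => rfl
  | invokeWrite | prewriteDone | writeDone | invokeRead | deliver =>
    exact Function.update_of_ne (hne rfl) _ _

theorem Step.inbox_append_chan_of_actor_ne {g g' : GlobalState P X} {l : Label P X}
    (h : Step 𝓕 𝓠 w F g l g') (hl : l.actor w ≠ some i) (k : P) :
    g.inbox l k i ++ g'.chan i k = g.chan i k := by
  have hne : ∀ {a}, l.actor w = some a → i ≠ a := fun ha hia => hl (hia ▸ ha)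
  cases h with
  | stutter => rfl
  | byzSend j b =>
    rw [GlobalState.setChan_chan, if_neg fun h => hne rfl h.1.symm]
    rfl
  | deliverFaulty j b m rest _ hm => exact g.inbox_append_setChan hm i k
  | deliver j b m rest s' out res _ hm =>
    rw [GlobalState.act_chan, if_neg (hne rfl), List.append_nil, g.inbox_append_setChan hm]
  | invokeWrite | prewriteDone | writeDone | invokeRead =>
    rw [GlobalState.act_chan, if_neg (hne rfl), List.append_nil]
    rfl

theorem Step.exists_localStep {g g' : GlobalState P X} {l : Label P X}
    (h : Step 𝓕 𝓠 w F g l g') (hi : i ∉ F) :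
    ∃ out, LocalStep 𝓕 𝓠 w i (g.proc i) l (g.inbox l i) (g'.proc i) out ∧
      ∀ k, g.inbox l k i ++ g'.chan i k = g.chan i k ++ out k := by
  by_cases hl : l.actor w = some i
  · exact h.exists_localStep_of_actor hi hl
  · refine ⟨.silent, ?_, fun k => ?_⟩
    · rw [h.proc_eq_of_actor_ne hl, funext (g.inbox_eq_nil hl)]
      exact .skip l hl
    · rw [h.inbox_append_chan_of_actor_ne hl, Outbox.silent, List.append_nil]

namespace Msg

/-- The messages of the writer to the replicas. -/
def isWriter : Msg X → Bool
  | .prewrite _ _ | .write _ _ => true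
  | _ => false

/-- The answers to `prewrite` messages. -/
def isPreack : Msg X → Bool
  | .preack => true
  | _ => false

/-- The answers to `write` messages. -/
def isAck : Msg X → Bool
  | .ack => true
  | _ => false

end Msg

/-- The message that a correct writer sends after `c` earlier ones when `val t` is the value of its
`t`-th write: `prewrite` and `write` messages alternate. -/
def writerMsg (val : ℕ → X) (c : ℕ) : Msg X :=
  if c % 2 = 0 then .prewrite (c / 2 + 1) (val (c / 2 + 1))
  else .write (c / 2 + 1) (val (c / 2 + 1))

/-- The state of a correct replica that has received the first `c` messages of the writer. -/
def replicaEntry (val : ℕ → X) (c : ℕ) : Entry X :=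
  ⟨(c + 1) / 2, val ((c + 1) / 2), c / 2, val (c / 2)⟩

/-- The answer to the message `read r` of a replica whose state is `e`. -/
def Entry.reply (e : Entry X) (r : ℕ) : Msg X := .value r e.pts e.pv e.ts e.v

namespace LocalState

/-- The pre-written and the written pair that a replica stores. -/
def entry (s : LocalState P X) : Entry X := ⟨s.pts, s.pv, s.ts, s.v⟩

/-- The number of messages that a correct writer has sent to each replica. -/
def stage (s : LocalState P X) : ℕ :=
  match s.phase with
  | .prewriting _ => 2 * s.wts - 1
  | _ => 2 * s.wts

/-- A write of `x` is pending. -/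
def IsWriting (s : LocalState P X) (x : X) : Prop := s.phase = .prewriting x ∨ s.phase = .writing x

/-- The pending write of a correct writer, if any, is its `wts`-th one, when `val t` is the value of
its `t`-th write. -/
def WriterInv (val : ℕ → X) (s : LocalState P X) : Prop :=
  ∀ x, s.IsWriting x → 0 < s.wts ∧ x = val s.wts

end LocalState

section Writer

variable {val : ℕ → X} {s s' : LocalState P X} {l : Label P X} {inp : P → List (Msg X)}
  {out : Outbox P X} {j : P} {m : Msg X} {res : Option X}

theorem isWriter_writerMsg (c : ℕ) : (writerMsg val c).isWriter := by
  unfold writerMsg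
  split_ifs <;> rfl

theorem writerMsg_two_mul (t : ℕ) : writerMsg val (2 * t) = .prewrite (t + 1) (val (t + 1)) := by
  simp [writerMsg]

theorem writerMsg_two_mul_add_one (t : ℕ) :
    writerMsg val (2 * t + 1) = .write (t + 1) (val (t + 1)) := by
  simp [writerMsg, Nat.add_mod, show (2 * t + 1) / 2 = t by omega]

theorem Receive.wts_eq (h : Receive 𝓕 𝓠 w i j s m s' out res) : s'.wts = s.wts := by
  cases h <;> rfl

theorem Receive.phase_eq (h : Receive 𝓕 𝓠 w i j s m s' out none) : s'.phase = s.phase := by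
  cases h <;> rfl

theorem Receive.phase_eq_reading {x : X} (h : Receive 𝓕 𝓠 w i j s m s' out (some x)) :
    s.phase = .reading ∧ s'.phase = .idle := by
  cases h with
  | valueReturn _ _ _ _ _ _ _ hg => exact ⟨hg.1, rfl⟩

theorem Receive.stage_eq (h : Receive 𝓕 𝓠 w i j s m s' out res) : s'.stage = s.stage := by
  unfold LocalState.stage
  rw [h.wts_eq]
  cases res with
  | none => rw [h.phase_eq]
  | some x => rw [h.phase_eq_reading.1, h.phase_eq_reading.2]

theorem Receive.isWriting_iff (h : Receive 𝓕 𝓠 w i j s m s' out res) (x : X) :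
    s'.IsWriting x ↔ s.IsWriting x := by
  unfold LocalState.IsWriting
  cases res with
  | none => rw [h.phase_eq]
  | some y => simp [h.phase_eq_reading]

theorem Receive.filter_isWriter_eq_nil (h : Receive 𝓕 𝓠 w i j s m s' out res) (k : P) :
    (out k).filter Msg.isWriter = [] := by
  cases h <;> simp only [Outbox.silent, Outbox.to, Outbox.toAll] <;> try split_ifs
  all_goals rfl

theorem LocalStep.writerInv (h : LocalStep 𝓕 𝓠 w w s l inp s' out)
    (hval : ∀ x, l = .invokeWrite x → x = val (s.wts + 1)) (hs : s.WriterInv val) :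
    s'.WriterInv val := by
  cases h with
  | skip => exact hs
  | invokeWrite x => simpa [LocalState.WriterInv, LocalState.IsWriting] using hval x rfl
  | prewriteDone x _ hph =>
    simpa [LocalState.WriterInv, LocalState.IsWriting] using hs x (.inl hph)
  | writeDone => simp [LocalState.WriterInv, LocalState.IsWriting]
  | invokeRead => simp [LocalState.WriterInv, LocalState.IsWriting]
  | receive j m s' out res hr =>
    intro x hx
    rw [hr.wts_eq]
    exact hs x ((hr.isWriting_iff x).1 hx)

theorem LocalStep.stage_cases (h : LocalStep 𝓕 𝓠 w w s l inp s' out)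
    (hval : ∀ x, l = .invokeWrite x → x = val (s.wts + 1)) (hs : s.WriterInv val) (k : P) :
    (s'.stage = s.stage ∧ (out k).filter Msg.isWriter = []) ∨
      (s'.stage = s.stage + 1 ∧ (out k).filter Msg.isWriter = [writerMsg val s.stage]) := by
  cases h with
  | skip => exact .inl ⟨rfl, rfl⟩
  | invokeWrite x _ hph =>
    have hstage : s.stage = 2 * s.wts := by simp [LocalState.stage, hph]
    refine .inr ⟨?_, ?_⟩
    · rw [hstage]
      rfl
    · rw [hstage, writerMsg_two_mul, ← hval x rfl]
      rfl
  | prewriteDone x _ hph =>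
    obtain ⟨hpos, hx⟩ := hs x (.inl hph)
    obtain ⟨t, ht⟩ := Nat.exists_eq_add_one.2 hpos
    have hstage : s.stage = 2 * t + 1 := by
      simp only [LocalState.stage, hph, ht]
      omega
    refine .inr ⟨?_, ?_⟩
    · rw [hstage]
      exact congrArg (2 * ·) ht
    · rw [hstage, writerMsg_two_mul_add_one, ← ht, ← hx]
      rfl
  | writeDone _ hq =>
    obtain ⟨x, hph⟩ := hq.1
    refine .inl ⟨?_, rfl⟩
    simp [LocalState.stage, hph]
  | invokeRead hph =>
    refine .inl ⟨?_, rfl⟩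
    simp [LocalState.stage, hph]
  | receive j m s' out res hr => exact .inl ⟨hr.stage_eq, hr.filter_isWriter_eq_nil k⟩

end Writer

section Replica

variable {val : ℕ → X} {s s' : LocalState P X} {l : Label P X} {inp : P → List (Msg X)}
  {out : Outbox P X} {j : P} {m : Msg X} {res : Option X} {c : ℕ}

theorem carries_replicaEntry {t : ℕ} {x : X} (h : (replicaEntry val c).Carries t x) :
    x = val t ∧ c / 2 ≤ t ∧ t ≤ (c + 1) / 2 := by
  rcases h with h | h <;> obtain ⟨ht, hx⟩ := Prod.mk.inj h <;> subst ht hx <;>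
    refine ⟨rfl, ?_, ?_⟩ <;> simp only [replicaEntry] <;> omega

theorem replicaEntry_wellFormed (val : ℕ → X) (c : ℕ) :
    (replicaEntry val c).pts = (replicaEntry val c).ts + 1 ∨
      ((replicaEntry val c).pts, (replicaEntry val c).pv) =
        ((replicaEntry val c).ts, (replicaEntry val c).v) := by
  have h : (c + 1) / 2 = c / 2 + 1 ∨ (c + 1) / 2 = c / 2 := by omega
  exact h.imp id fun h => by simp only [replicaEntry, h]

theorem Receive.entry_eq (h : Receive 𝓕 𝓠 w i j s m s' out res)
    (hm : ¬ (j = w ∧ m.isWriter)) :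
    s'.entry = s.entry ∧ (out w).countP Msg.isPreack = 0 ∧ (out w).countP Msg.isAck = 0 := by
  cases h with
  | prewrite _ _ hg => exact absurd ⟨hg.1, rfl⟩ hm
  | write _ _ hg => exact absurd ⟨hg.1, rfl⟩ hm
  | read =>
    refine ⟨rfl, ?_⟩
    unfold Outbox.to
    split_ifs <;> exact ⟨rfl, rfl⟩
  | _ => exact ⟨rfl, rfl, rfl⟩

theorem Receive.entry_eq_replicaEntry (h : Receive 𝓕 𝓠 w i w s (writerMsg val c) s' out res)
    (hs : s.entry = replicaEntry val c) :
    s'.entry = replicaEntry val (c + 1) ∧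
      (c + 1) / 2 + (out w).countP Msg.isPreack = (c + 2) / 2 ∧
      c / 2 + (out w).countP Msg.isAck = (c + 1) / 2 := by
  obtain ⟨hpts, hpv, hts, hv⟩ := (Entry.mk.injEq ..).mp hs
  obtain ⟨t, rfl | rfl⟩ := Nat.even_or_odd' c
  · have h1 : (2 * t + 1) / 2 = t := by omega
    have h2 : (2 * t + 2) / 2 = t + 1 := by omega
    have h3 : 2 * t / 2 = t := by omega
    rw [h1] at hpts hpv
    rw [h3] at hts hv
    rw [writerMsg_two_mul] at h
    cases h with
    | prewrite _ _ hg =>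
      simp [LocalState.entry, replicaEntry, h1, h2, h3, hts, hv, Outbox.to, Msg.isPreack, Msg.isAck]
    | prewriteIgnored _ _ hg => exact absurd ⟨rfl, by rw [hpts], hpts.trans hts.symm⟩ hg
  · have h1 : (2 * t + 1) / 2 = t := by omega
    have h2 : (2 * t + 1 + 1) / 2 = t + 1 := by omega
    have h3 : (2 * t + 1 + 2) / 2 = t + 1 := by omega
    rw [h2] at hpts hpv
    rw [writerMsg_two_mul_add_one] at h
    cases h with
    | write _ _ hg =>
      simp [LocalState.entry, replicaEntry, h1, h2, h3, hpts, hpv, Outbox.to, Msg.isPreack,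
        Msg.isAck]
    | writeIgnored _ _ hg => exact absurd ⟨rfl, hpts.symm, hpv.symm⟩ hg

theorem LocalStep.entry_eq_replicaEntry (h : LocalStep 𝓕 𝓠 w i s l inp s' out)
    (hs : s.entry = replicaEntry val c)
    (hinp : ∀ m ∈ inp w, m.isWriter → m = writerMsg val c) :
    s'.entry = replicaEntry val (c + (inp w).countP Msg.isWriter) ∧
      (c + 1) / 2 + (out w).countP Msg.isPreack =
        (c + (inp w).countP Msg.isWriter + 1) / 2 ∧
      c / 2 + (out w).countP Msg.isAck = (c + (inp w).countP Msg.isWriter) / 2 := by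
  cases h with
  | receive j m s' out res hr =>
    by_cases hm : j = w ∧ m.isWriter
    · obtain ⟨rfl, hm⟩ := hm
      obtain rfl := hinp m (by simp) hm
      have hinp1 : (if j = j then [writerMsg val c] else []).countP Msg.isWriter = 1 := by
        simp [isWriter_writerMsg]
      rw [hinp1]
      exact hr.entry_eq_replicaEntry hs
    · obtain ⟨hentry, hpre, hack⟩ := hr.entry_eq hm
      have hinp0 : (if w = j then [m] else []).countP Msg.isWriter = 0 := by
        split_ifs with hj
        · simpa using fun hw => hm ⟨hj.symm, hw⟩
        · rfl
      rw [hinp0, hpre, hack]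
      exact ⟨hentry.trans hs, rfl, rfl⟩
  | _ => exact ⟨hs, rfl, rfl⟩

theorem LocalStep.preacks_eq (h : LocalStep 𝓕 𝓠 w i s l inp s' out) (k : P) :
    s'.preacks k = s.preacks k + (inp k).countP Msg.isPreack := by
  cases h with
  | receive j m s' out res hr =>
    by_cases hk : k = j
    · subst hk
      cases hr <;> simp [Msg.isPreack]
    · cases hr <;> simp [hk]
  | _ => rfl

theorem LocalStep.acks_eq (h : LocalStep 𝓕 𝓠 w i s l inp s' out) (k : P) :
    s'.acks k = s.acks k + (inp k).countP Msg.isAck := by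
  cases h with
  | receive j m s' out res hr =>
    by_cases hk : k = j
    · subst hk
      cases hr <;> simp [Msg.isAck]
    · cases hr <;> simp [hk]
  | _ => rfl

end Replica

section Reader

variable {s s' : LocalState P X} {l : Label P X} {inp : P → List (Msg X)}
  {out : Outbox P X} {k : P} {e : Entry X} {r : ℕ}

theorem LocalStep.rid_le (h : LocalStep 𝓕 𝓠 w i s l inp s' out) : s.rid ≤ s'.rid := by
  cases h with
  | invokeRead => exact Nat.le_succ _
  | receive _ _ _ _ _ hr => cases hr <;> rfl
  | _ => rfl

theorem LocalStep.rid_eq_of_read_mem (h : LocalStep 𝓕 𝓠 w i s l inp s' out)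
    (hr : .read r ∈ out k) : r = s'.rid := by
  cases h with
  | invokeRead => simpa [Outbox.toAll] using hr
  | receive j m s' out res hrec =>
    cases hrec with
    | valueRetry => simpa [Outbox.toAll] using hr
    | prewrite | write | read =>
      simp only [Outbox.to] at hr
      split_ifs at hr <;> simp at hr
    | _ => simp [Outbox.silent] at hr
  | _ => simp [Outbox.toAll, Outbox.silent] at hr

theorem LocalStep.entry_eq_of_reply_mem (h : LocalStep 𝓕 𝓠 w i s l inp s' out)
    (he : e.reply r ∈ out k) : s.entry = e ∧ .read r ∈ inp k := by
  cases h with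
  | receive j m s' out res hrec =>
    cases hrec with
    | read r' =>
      simp only [Outbox.to] at he
      split_ifs at he with hk
      · obtain ⟨rfl, h1, h2, h3, h4⟩ := by simpa [Entry.reply] using he
        cases e
        simp_all [LocalState.entry]
      · simp at he
    | valueRetry => simp [Outbox.toAll, Entry.reply] at he
    | prewrite | write =>
      simp only [Outbox.to] at he
      split_ifs at he <;> simp [Entry.reply] at he
    | _ => simp [Outbox.silent] at he
  | _ => simp [Outbox.toAll, Outbox.silent, Entry.reply] at he

theorem LocalStep.readlist_cases (h : LocalStep 𝓕 𝓠 w i s l inp s' out) (k : P) :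
    (l = .invokeRead i ∧ s'.readlist k = none) ∨
      s'.rid = s.rid ∧ (s'.readlist k = s.readlist k ∨
        ∃ e : Entry X, e.reply s.rid ∈ inp k ∧ s'.readlist k = some e) := by
  cases h with
  | invokeRead => exact .inl ⟨rfl, rfl⟩
  | receive j m s' out res hrec =>
    refine .inr ?_
    by_cases hk : k = j
    · subst hk
      cases hrec with
      | valueReturn r pts pv ts v t x hg | valueRetry r pts pv ts v hg =>
        obtain rfl := hg.2.1
        exact ⟨rfl, .inr ⟨⟨pts, pv, ts, v⟩, by simp [Entry.reply], by simp⟩⟩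
      | _ => exact ⟨rfl, .inl rfl⟩
    · cases hrec <;> simp [hk]
  | _ => exact .inr ⟨rfl, .inl rfl⟩

theorem LocalStep.of_invokeRead (h : LocalStep 𝓕 𝓠 w i s (.invokeRead i) inp s' out) :
    s'.phase = .reading ∧ s'.rid = s.rid + 1 ∧ (∀ k, s'.readlist k = none) ∧
      ∀ k, .read s'.rid ∈ out k := by
  cases h with
  | skip _ hl => exact absurd rfl hl
  | invokeRead => simp [Outbox.toAll]

theorem LocalStep.exists_selects {j : P} {x : X}
    (h : LocalStep 𝓕 𝓠 w i s (.deliver j i (some x)) inp s' out) :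
    ∃ t, Selects 𝓕 𝓠 i s'.readlist t x := by
  cases h with
  | skip _ hl => exact absurd rfl hl
  | receive _ _ _ _ _ hr =>
    cases hr with
    | valueReturn _ _ _ _ _ t _ _ hsel => exact ⟨t, hsel⟩

theorem LocalStep.reply_mem (h : LocalStep 𝓕 𝓠 w i s l inp s' out) (hr : .read r ∈ inp k) :
    s.entry.reply r ∈ out k := by
  cases h with
  | receive j m s' out res hrec =>
    obtain ⟨rfl, rfl⟩ : k = j ∧ m = .read r := by
      by_cases hk : k = j <;> simp_all
    cases hrec with
    | read => simp [Outbox.to, Entry.reply, LocalState.entry]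
  | _ => cases hr

theorem LocalStep.of_reply_mem (h : LocalStep 𝓕 𝓠 w i s l inp s' out) (hs : s.phase = .reading)
    (hl : ∀ e, l.event w ≠ some (i, e)) (he : e.reply s.rid ∈ inp k)
    (hwf : e.pts = e.ts + 1 ∨ (e.pts, e.pv) = (e.ts, e.v)) :
    s'.readlist k = some e ∧ (∀ t x, ¬ Selects 𝓕 𝓠 i s'.readlist t x) ∧
      ∀ j, .read s.rid ∈ out j := by
  cases h with
  | receive j m s' out res hrec =>
    obtain ⟨rfl, rfl⟩ : k = j ∧ m = e.reply s.rid := by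
      by_cases hk : k = j <;> simp_all
    cases hrec with
    | valueReturn => exact absurd rfl (hl _)
    | valueRetry _ _ _ _ _ _ hsel => exact ⟨by simp, hsel, by simp [Outbox.toAll]⟩
    | valueIgnored _ _ _ _ _ hg => exact absurd ⟨hs, rfl, hwf⟩ hg
  | _ => cases he

end Reader

section Pending

variable {s s' : LocalState P X} {l : Label P X} {inp : P → List (Msg X)} {out : Outbox P X} {x : X}

theorem LocalStep.of_invokeWrite (h : LocalStep 𝓕 𝓠 w w s (.invokeWrite x) inp s' out) :
    s.phase = .idle ∧ s'.phase = .prewriting x ∧ s'.wts = s.wts + 1 := by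
  cases h with
  | skip _ hl => exact absurd rfl hl
  | invokeWrite _ _ hph => exact ⟨hph, rfl, rfl⟩

theorem LocalStep.of_prewriteDone (h : LocalStep 𝓕 𝓠 w w s .prewriteDone inp s' out) :
    ∃ x, s'.phase = .writing x := by
  cases h with
  | skip _ hl => exact absurd rfl hl
  | prewriteDone x => exact ⟨x, rfl⟩

theorem LocalStep.of_writeDone (h : LocalStep 𝓕 𝓠 w w s .writeDone inp s' out) :
    AckQuorum 𝓠 w s ∧ s'.phase = .idle := by
  cases h with
  | skip _ hl => exact absurd rfl hl
  | writeDone _ hq => exact ⟨hq, rfl⟩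

theorem LocalStep.wts_le (h : LocalStep 𝓕 𝓠 w i s l inp s' out) : s.wts ≤ s'.wts := by
  cases h with
  | invokeWrite => exact Nat.le_succ _
  | receive _ _ _ _ _ hr => exact hr.wts_eq.ge
  | _ => exact le_rfl

theorem LocalStep.wts_eq (h : LocalStep 𝓕 𝓠 w i s l inp s' out)
    (hl : ∀ x, l ≠ .invokeWrite x) : s'.wts = s.wts := by
  cases h with
  | invokeWrite x => exact absurd rfl (hl x)
  | receive _ _ _ _ _ hr => exact hr.wts_eq
  | _ => rfl

theorem LocalStep.isWriting_of_event_ne (h : LocalStep 𝓕 𝓠 w i s l inp s' out)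
    (hs : s.IsWriting x) (hl : ∀ e, l.event w ≠ some (i, e)) : s'.IsWriting x := by
  cases h with
  | skip => exact hs
  | invokeWrite _ hi => exact absurd (by rw [hi]; rfl) (hl _)
  | prewriteDone y _ hph =>
    have hyx : y = x := by simpa [LocalState.IsWriting, hph] using hs
    exact .inr (hyx ▸ rfl)
  | writeDone hi => exact absurd (by rw [hi]; rfl) (hl _)
  | invokeRead => exact absurd rfl (hl _)
  | receive j m s' out res hr => exact (hr.isWriting_iff x).2 hs

theorem LocalStep.event_eq_writeAck (h : LocalStep 𝓕 𝓠 w i s l inp s' out)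
    (hs : s.IsWriting x) {e : RegEvent X} (hl : l.event w = some (i, e)) : e = .writeAck := by
  have hne : s.phase ≠ .idle ∧ s.phase ≠ .reading := by rcases hs with hs | hs <;> simp [hs]
  cases h with
  | skip l hl' => exact absurd (Label.actor_of_event hl) hl'
  | invokeWrite _ _ hph => exact absurd hph hne.1
  | prewriteDone => cases hl
  | writeDone =>
    cases hl
    rfl
  | invokeRead hph => exact absurd hph hne.1
  | receive j m s' out res hr =>
    cases res with
    | none => cases hl
    | some y => exact absurd hr.phase_eq_reading.1 hne.2

theorem LocalStep.phase_eq_writing (h : LocalStep 𝓕 𝓠 w i s l inp s' out)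
    (hs : s.phase = .writing x) (hl : l ≠ .writeDone) : s'.phase = .writing x := by
  cases h with
  | writeDone => exact absurd rfl hl
  | skip => exact hs
  | receive j m s' out res hr =>
    cases res with
    | none => exact hr.phase_eq.trans hs
    | some y => simp [hr.phase_eq_reading.1] at hs
  | _ => simp_all

theorem LocalStep.phase_ne_prewriting (h : LocalStep 𝓕 𝓠 w i s l inp s' out)
    (hs : ∀ x, s.phase ≠ .prewriting x) (hl : ∀ x, l ≠ .invokeWrite x) (x : X) :
    s'.phase ≠ .prewriting x := by
  cases h with
  | skip => exact hs x
  | invokeWrite y => exact absurd rfl (hl y)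
  | receive j m s' out res hr =>
    cases res with
    | none => exact hr.phase_eq ▸ hs x
    | some y => simp [hr.phase_eq_reading.2]
  | _ => simp

theorem LocalStep.phase_eq_reading (h : LocalStep 𝓕 𝓠 w i s l inp s' out)
    (hs : s.phase = .reading) (hl : ∀ e, l.event w ≠ some (i, e)) :
    s'.phase = .reading ∧ s'.rid = s.rid := by
  cases h with
  | skip => exact ⟨hs, rfl⟩
  | receive j m s' out res hr =>
    cases res with
    | none => exact ⟨hr.phase_eq.trans hs, by cases hr <;> rfl⟩
    | some x => exact absurd rfl (hl (.readRet x))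
  | writeDone _ hq =>
    obtain ⟨y, hy⟩ := hq.1
    simp [hy] at hs
  | _ => simp_all

theorem LocalStep.event_eq_readRet (h : LocalStep 𝓕 𝓠 w i s l inp s' out)
    (hs : s.phase = .reading) {e : RegEvent X} (hl : l.event w = some (i, e)) :
    ∃ x, e = .readRet x := by
  cases h with
  | skip l hl' => exact absurd (Label.actor_of_event hl) hl'
  | prewriteDone => cases hl
  | writeDone _ hq =>
    obtain ⟨y, hy⟩ := hq.1
    simp [hy] at hs
  | receive j m s' out res hr =>
    cases res with
    | none => cases hl
    | some x =>
      cases hl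
      exact ⟨x, rfl⟩
  | _ => simp_all

end Pending

end LocalStep

namespace Execution

variable {P X : Type*} [DecidableEq P] {𝓕 𝓠 : P → Set (Set P)} {w : P} {x₀ : X} {F : Set P}
  (σ : Execution 𝓕 𝓠 w x₀ F) {i j k p : P} {n m : ℕ}

/-- The local state of `i` at time `n`. -/
abbrev proc (i : P) (n : ℕ) : LocalState P X := (σ.state n).proc i

/-- The messages that `i` receives from each process in step `n`. -/
def inbox (i : P) (n : ℕ) (j : P) : List (Msg X) := (σ.state n).inbox (σ.step n) i j

/-- The messages from `j` that `i` has received before step `n`, oldest first. -/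
def received (j i : P) : ℕ → List (Msg X)
  | 0 => []
  | n + 1 => received j i n ++ σ.inbox i n j

/-- The messages that `j` has sent to `i` before step `n`, oldest first. -/
def sent (j i : P) (n : ℕ) : List (Msg X) := σ.received j i n ++ (σ.state n).chan j i

/-- The messages that `i` sends in step `n`. -/
def outbox (i : P) (n : ℕ) : Outbox P X := fun k =>
  (σ.sent i k (n + 1)).drop (σ.sent i k n).length

section Links

theorem exists_localStep (hi : i ∉ F) (n : ℕ) :
    ∃ out, LocalStep 𝓕 𝓠 w i (σ.proc i n) (σ.step n) (σ.inbox i n) (σ.proc i (n + 1)) out ∧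
      ∀ k, σ.sent i k (n + 1) = σ.sent i k n ++ out k := by
  obtain ⟨out, hstep, hout⟩ := (σ.next n).exists_localStep hi
  refine ⟨out, hstep, fun k => ?_⟩
  rw [sent, received, List.append_assoc, inbox, hout k, ← List.append_assoc, sent]

theorem localStep (hi : i ∉ F) (n : ℕ) :
    LocalStep 𝓕 𝓠 w i (σ.proc i n) (σ.step n) (σ.inbox i n) (σ.proc i (n + 1)) (σ.outbox i n) := by
  obtain ⟨out, hstep, hout⟩ := σ.exists_localStep hi n
  have : σ.outbox i n = out := funext fun k => by rw [outbox, hout k, List.drop_left]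
  rwa [this]

theorem sent_succ (hi : i ∉ F) (k : P) (n : ℕ) :
    σ.sent i k (n + 1) = σ.sent i k n ++ σ.outbox i n k := by
  obtain ⟨out, -, hout⟩ := σ.exists_localStep hi n
  rw [outbox, hout k, List.drop_left]

theorem sent_zero (j i : P) : σ.sent j i 0 = [] := by
  rw [sent, received, σ.init]
  rfl

theorem received_succ_prefix_sent (j i : P) (n : ℕ) : σ.received j i (n + 1) <+: σ.sent j i n :=
  (List.prefix_append_right_inj _).2 ((σ.state n).inbox_prefix_chan _ _ _)

theorem received_prefix_sent (j i : P) (n : ℕ) : σ.received j i n <+: σ.sent j i n :=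
  List.prefix_append _ _

theorem exists_sent_eq_append (hj : j ∉ F) (i : P) (hnm : n ≤ m) :
    ∃ l, σ.sent j i m = σ.sent j i n ++ l ∧ ∀ x ∈ l, ∃ k, n ≤ k ∧ k < m ∧ x ∈ σ.outbox j k i :=
  exists_append_eq_of_succ (σ.sent_succ hj i) hnm

theorem exists_received_eq_append (j i : P) (hnm : n ≤ m) :
    ∃ l, σ.received j i m = σ.received j i n ++ l ∧
      ∀ x ∈ l, ∃ k, n ≤ k ∧ k < m ∧ x ∈ σ.inbox i k j :=
  exists_append_eq_of_succ (fun _ => rfl) hnm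

theorem sent_prefix_sent (hj : j ∉ F) (i : P) (hnm : n ≤ m) : σ.sent j i n <+: σ.sent j i m :=
  let ⟨l, hl, _⟩ := σ.exists_sent_eq_append hj i hnm
  ⟨l, hl.symm⟩

theorem received_prefix_received (j i : P) (hnm : n ≤ m) :
    σ.received j i n <+: σ.received j i m :=
  let ⟨l, hl, _⟩ := σ.exists_received_eq_append j i hnm
  ⟨l, hl.symm⟩

theorem exists_mem_outbox_of_mem_inbox (hj : j ∉ F) {x : Msg X} (hx : x ∈ σ.inbox i n j) :
    ∃ k < n, x ∈ σ.outbox j k i := by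
  obtain ⟨l, hl, hlout⟩ := σ.exists_sent_eq_append hj i n.zero_le
  have hxl : x ∈ l := by
    rw [sent_zero, List.nil_append] at hl
    exact hl ▸ (σ.received_succ_prefix_sent j i n).subset (List.mem_append_right _ hx)
  obtain ⟨k, -, hkn, hk⟩ := hlout x hxl
  exact ⟨k, hkn, hk⟩

end Links

section History

theorem history_eq_writeInv {x : X} :
    σ.history n = some (p, .writeInv x) ↔ p = w ∧ σ.step n = .invokeWrite x := by
  unfold history
  rcases σ.step n with _ | _ | _ | _ | _ | ⟨_, _, _ | _⟩ | _ <;> simp [Label.event, eq_comm]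

theorem history_eq_writeAck :
    σ.history n = some (p, .writeAck) ↔ p = w ∧ σ.step n = .writeDone := by
  unfold history
  rcases σ.step n with _ | _ | _ | _ | _ | ⟨_, _, _ | _⟩ | _ <;> simp [Label.event, eq_comm]

theorem history_eq_readInv :
    σ.history n = some (p, .readInv) ↔ σ.step n = .invokeRead p := by
  unfold history
  rcases σ.step n with _ | _ | _ | _ | _ | ⟨_, _, _ | _⟩ | _ <;> simp [Label.event]

theorem history_eq_readRet {x : X} :
    σ.history n = some (p, .readRet x) ↔ ∃ j, σ.step n = .deliver j p (some x) := by
  unfold history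
  rcases σ.step n with _ | _ | _ | _ | _ | ⟨_, _, _ | _⟩ | _ <;> simp [Label.event]

end History

section Writer

open Classical in
/-- The value of the `t`-th write, or `x₀` if there is no such write. -/
noncomputable def val (t : ℕ) : X :=
  if h : ∃ x n, σ.step n = .invokeWrite x ∧ (σ.proc w n).wts + 1 = t then h.choose else x₀

theorem val_zero : σ.val 0 = x₀ := dif_neg (by simp)

theorem wts_monotone (hw : w ∉ F) : Monotone fun n => (σ.proc w n).wts :=
  monotone_nat_of_le_succ fun n => (σ.localStep hw n).wts_le

theorem wts_succ_of_invokeWrite (hw : w ∉ F) {x : X} (hn : σ.step n = .invokeWrite x) :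
    (σ.proc w (n + 1)).wts = (σ.proc w n).wts + 1 := by
  have h := σ.localStep hw n
  rw [hn] at h
  exact h.of_invokeWrite.2.2

theorem wts_succ_le_of_invokeWrite (hw : w ∉ F) {x : X} (hn : σ.step n = .invokeWrite x)
    (hnm : n < m) : (σ.proc w n).wts + 1 ≤ (σ.proc w m).wts :=
  (σ.wts_succ_of_invokeWrite hw hn).ge.trans (σ.wts_monotone hw hnm)

theorem val_of_invokeWrite (hw : w ∉ F) {x : X} (hn : σ.step n = .invokeWrite x) :
    x = σ.val ((σ.proc w n).wts + 1) := by
  have hex : ∃ x m, σ.step m = .invokeWrite x ∧ (σ.proc w m).wts + 1 = (σ.proc w n).wts + 1 :=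
    ⟨x, n, hn, rfl⟩
  obtain ⟨m, hm, hwts⟩ := hex.choose_spec
  obtain rfl : n = m := by
    rcases lt_trichotomy n m with h | h | h
    · have := σ.wts_succ_le_of_invokeWrite hw hn h
      omega
    · exact h
    · have := σ.wts_succ_le_of_invokeWrite hw hm h
      omega
  rw [val, dif_pos hex]
  exact Label.invokeWrite.inj (hn.symm.trans hm)

theorem exists_invokeWrite (hw : w ∉ F) {t : ℕ} (ht : 0 < t) (htn : t ≤ (σ.proc w n).wts) :
    ∃ a < n, σ.step a = .invokeWrite (σ.val t) ∧ (σ.proc w a).wts + 1 = t := by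
  induction n with
  | zero =>
    rw [proc, σ.init] at htn
    exact absurd htn ht.not_ge
  | succ n ih =>
    by_cases htn' : t ≤ (σ.proc w n).wts
    · obtain ⟨a, han, ha⟩ := ih htn'
      exact ⟨a, han.trans n.lt_succ_self, ha⟩
    · by_cases hn : ∃ x, σ.step n = .invokeWrite x
      · obtain ⟨x, hx⟩ := hn
        have ht : (σ.proc w n).wts + 1 = t := by
          have := σ.wts_succ_of_invokeWrite hw hx
          omega
        exact ⟨n, n.lt_succ_self, ht ▸ σ.val_of_invokeWrite hw hx ▸ hx, ht⟩
      · have := (σ.localStep hw n).wts_eq fun x hx => hn ⟨x, hx⟩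
        omega

theorem writerInv (hw : w ∉ F) (n : ℕ) : (σ.proc w n).WriterInv σ.val := by
  induction n with
  | zero =>
    rw [proc, σ.init]
    simp [LocalState.WriterInv, LocalState.IsWriting, GlobalState.init, LocalState.init]
  | succ n ih => exact (σ.localStep hw n).writerInv (fun _ => σ.val_of_invokeWrite hw) ih

theorem filter_isWriter_sent (hw : w ∉ F) (i : P) (n : ℕ) :
    (σ.sent w i n).filter Msg.isWriter =
      (List.range (σ.proc w n).stage).map (writerMsg σ.val) := by
  induction n with
  | zero =>
    rw [sent_zero, proc, σ.init]
    rfl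
  | succ n ih =>
    rw [σ.sent_succ hw, List.filter_append, ih]
    rcases (σ.localStep hw n).stage_cases (fun _ => σ.val_of_invokeWrite hw) (σ.writerInv hw n) i
      with ⟨hstage, hout⟩ | ⟨hstage, hout⟩
    · rw [hstage, hout, List.append_nil]
    · rw [hstage, hout, List.range_succ, List.map_append, List.map_singleton]

end Writer

section Replica

/-- The number of messages of the writer that the replica `i` has processed. -/
def progress (i : P) (n : ℕ) : ℕ := (σ.received w i n).countP Msg.isWriter

theorem progress_monotone (i : P) : Monotone (σ.progress i) :=
  fun _ _ hnm => (σ.received_prefix_received w i hnm).sublist.countP_le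

theorem countP_isWriter_sent (hw : w ∉ F) (i : P) (n : ℕ) :
    (σ.sent w i n).countP Msg.isWriter = (σ.proc w n).stage := by
  rw [List.countP_eq_length_filter, σ.filter_isWriter_sent hw, List.length_map, List.length_range]

theorem progress_le_stage (hw : w ∉ F) (i : P) (n : ℕ) : σ.progress i n ≤ (σ.proc w n).stage :=
  σ.countP_isWriter_sent hw i n ▸ (σ.received_prefix_sent w i n).sublist.countP_le

theorem eq_writerMsg_of_mem_inbox (hw : w ∉ F) {x : Msg X} (hx : x ∈ σ.inbox i n w)
    (hxw : x.isWriter) : x = writerMsg σ.val (σ.progress i n) := by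
  have hprefix := (σ.received_succ_prefix_sent w i n).filter Msg.isWriter
  rw [received, show σ.inbox i n w = [x] from GlobalState.inbox_eq_singleton hx,
    List.filter_append, List.filter_singleton, hxw, σ.filter_isWriter_sent hw] at hprefix
  have hlen : σ.progress i n = ((σ.received w i n).filter Msg.isWriter).length :=
    List.countP_eq_length_filter
  have hget := hprefix.getElem (i := σ.progress i n) (by simp [hlen])
  simpa [hlen] using hget

theorem entry_eq_and_countP_sent (hw : w ∉ F) (hi : i ∉ F) (n : ℕ) :
    (σ.proc i n).entry = replicaEntry σ.val (σ.progress i n) ∧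
      (σ.sent i w n).countP Msg.isPreack = (σ.progress i n + 1) / 2 ∧
      (σ.sent i w n).countP Msg.isAck = σ.progress i n / 2 := by
  induction n with
  | zero =>
    rw [sent_zero, proc, σ.init]
    simp [progress, received, replicaEntry, val_zero, GlobalState.init, LocalState.init,
      LocalState.entry]
  | succ n ih =>
    obtain ⟨hentry, hpre, hack⟩ := ih
    obtain ⟨hentry', hpre', hack'⟩ := (σ.localStep hi n).entry_eq_replicaEntry hentry
      fun x => σ.eq_writerMsg_of_mem_inbox hw
    have hprog : σ.progress i (n + 1) =
        σ.progress i n + (σ.inbox i n w).countP Msg.isWriter := List.countP_append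
    rw [hprog, σ.sent_succ hi, List.countP_append, List.countP_append, hpre, hack]
    exact ⟨hentry', hpre', hack'⟩

theorem preacks_eq (hi : i ∉ F) (j : P) (n : ℕ) :
    (σ.proc i n).preacks j = (σ.received j i n).countP Msg.isPreack := by
  induction n with
  | zero =>
    rw [proc, σ.init]
    rfl
  | succ n ih => rw [(σ.localStep hi n).preacks_eq, ih, received, List.countP_append]

theorem acks_eq (hi : i ∉ F) (j : P) (n : ℕ) :
    (σ.proc i n).acks j = (σ.received j i n).countP Msg.isAck := by
  induction n with
  | zero =>
    rw [proc, σ.init]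
    rfl
  | succ n ih => rw [(σ.localStep hi n).acks_eq, ih, received, List.countP_append]

end Replica

section Fairness

variable {σ}

theorem Fair.exists_le_length_received (hfair : σ.Fair) (hj : j ∉ F) (hi : i ∉ F) (n : ℕ) {q : ℕ}
    (hq : q ≤ (σ.sent j i n).length) : ∃ m, q ≤ (σ.received j i m).length := by
  induction q with
  | zero => exact ⟨0, Nat.zero_le _⟩
  | succ q ih =>
    obtain ⟨m₀, hm₀⟩ := ih (Nat.le_of_succ_le hq)
    by_cases hchan : ∀ m, max m₀ n ≤ m → (σ.state m).chan j i ≠ []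
    · obtain ⟨m, hm, res, hstep⟩ := hfair.delivery j i hi _ hchan
      refine ⟨m + 1, ?_⟩
      have hin : 0 < (σ.inbox i m j).length := by
        have := List.length_pos_iff.2 (hchan m hm)
        simp only [inbox, GlobalState.inbox, hstep, and_self, if_true, List.length_take]
        omega
      have hrec := (σ.received_prefix_received j i (le_of_max_le_left hm)).length_le
      rw [received, List.length_append]
      omega
    · push Not at hchan
      obtain ⟨m, hm, hempty⟩ := hchan
      have hsent : σ.received j i m = σ.sent j i m := by rw [sent, hempty, List.append_nil]
      have hlen := (σ.sent_prefix_sent hj i (le_of_max_le_right hm)).length_le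
      exact ⟨m, hsent ▸ hq.trans hlen⟩

theorem Fair.eventually_sent_prefix_received (hfair : σ.Fair) (hj : j ∉ F) (hi : i ∉ F) (n : ℕ) :
    ∀ᶠ m in Filter.atTop, σ.sent j i n <+: σ.received j i m := by
  obtain ⟨m₀, hm₀⟩ := hfair.exists_le_length_received hj hi n le_rfl
  filter_upwards [Filter.eventually_ge_atTop m₀, Filter.eventually_ge_atTop n] with m hm₀m hnm
  have hlen := (σ.received_prefix_received j i hm₀m).length_le
  exact List.prefix_of_prefix_length_le (σ.sent_prefix_sent hj i hnm)
    (σ.received_prefix_sent j i m) (hm₀.trans hlen)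

theorem Fair.exists_mem_inbox (hfair : σ.Fair) (hj : j ∉ F) (hi : i ∉ F) {x : Msg X}
    (hx : x ∈ σ.outbox j n i) : ∃ m, n < m ∧ x ∈ σ.inbox i m j := by
  obtain ⟨m, hm, hnm⟩ := ((hfair.eventually_sent_prefix_received hj hi (n + 1)).and
    (Filter.eventually_gt_atTop n)).exists
  obtain ⟨l, hl, hlin⟩ := σ.exists_received_eq_append j i hnm
  obtain ⟨l', hl'⟩ := σ.received_succ_prefix_sent j i n
  rw [σ.sent_succ hj, ← hl', hl, List.append_assoc, List.prefix_append_right_inj] at hm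
  obtain ⟨k, hnk, -, hk⟩ := hlin x (hm.subset (List.mem_append_right _ hx))
  exact ⟨k, hnk, hk⟩

-- FIFO: once everything sent before `n` has been received, only later messages arrive.
theorem Fair.eventually_inbox_subset (hfair : σ.Fair) (hj : j ∉ F) (hi : i ∉ F) (n : ℕ) :
    ∀ᶠ m in Filter.atTop, ∀ x ∈ σ.inbox i m j, ∃ k, n ≤ k ∧ k < m ∧ x ∈ σ.outbox j k i := by
  filter_upwards [hfair.eventually_sent_prefix_received hj hi n, Filter.eventually_ge_atTop n]
    with m ⟨l₁, hl₁⟩ hnm x hx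
  obtain ⟨l, hl, hlout⟩ := σ.exists_sent_eq_append hj i hnm
  have hprefix := σ.received_succ_prefix_sent j i m
  rw [received, ← hl₁, hl, List.append_assoc, List.prefix_append_right_inj] at hprefix
  exact hlout x (hprefix.subset (List.mem_append_right _ hx))

theorem Fair.eventually_countP_sent_le (hfair : σ.Fair) (hj : j ∉ F) (hi : i ∉ F) (n : ℕ)
    (f : Msg X → Bool) :
    ∀ᶠ m in Filter.atTop, (σ.sent j i n).countP f ≤ (σ.received j i m).countP f :=
  (hfair.eventually_sent_prefix_received hj hi n).mono fun _ hm => hm.sublist.countP_le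

theorem Fair.eventually_stage_le_progress (hfair : σ.Fair) (hw : w ∉ F) (hi : i ∉ F) (n : ℕ) :
    ∀ᶠ m in Filter.atTop, (σ.proc w n).stage ≤ σ.progress i m :=
  σ.countP_isWriter_sent hw i n ▸ hfair.eventually_countP_sent_le hw hi n _

theorem Fair.eventually_stage_le_preacks (hfair : σ.Fair) (hw : w ∉ F) (hj : j ∉ F) (n : ℕ) :
    ∀ᶠ m in Filter.atTop, ((σ.proc w n).stage + 1) / 2 ≤ (σ.proc w m).preacks j := by
  obtain ⟨m₀, hm₀⟩ := (hfair.eventually_stage_le_progress hw hj n).exists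
  filter_upwards [hfair.eventually_countP_sent_le hj hw m₀ Msg.isPreack] with m hm
  rw [(σ.entry_eq_and_countP_sent hw hj m₀).2.1] at hm
  rw [σ.preacks_eq hw]
  omega

theorem Fair.eventually_stage_le_acks (hfair : σ.Fair) (hw : w ∉ F) (hj : j ∉ F) (n : ℕ) :
    ∀ᶠ m in Filter.atTop, (σ.proc w n).stage / 2 ≤ (σ.proc w m).acks j := by
  obtain ⟨m₀, hm₀⟩ := (hfair.eventually_stage_le_progress hw hj n).exists
  filter_upwards [hfair.eventually_countP_sent_le hj hw m₀ Msg.isAck] with m hm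
  rw [(σ.entry_eq_and_countP_sent hw hj m₀).2.2] at hm
  rw [σ.acks_eq hw]
  omega

end Fairness

section Safety

theorem exists_quorum_le_ts_of_writePrecedes (hw : w ∉ F) {a : ℕ}
    (h : σ.history.WritePrecedes a n) :
    ∃ Q ∈ 𝓠 w, ∀ j ∈ Q, j ∉ F → ∀ m, n ≤ m → (σ.proc w a).wts + 1 ≤ (σ.proc j m).entry.ts := by
  obtain ⟨b, ⟨q, x, ha, hab, hb, -⟩, hbn⟩ := h
  obtain ⟨rfl, ha⟩ := σ.history_eq_writeInv.1 ha
  have hdone := σ.localStep hw b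
  rw [(σ.history_eq_writeAck.1 hb).2] at hdone
  obtain ⟨-, Q, hQ, hacks⟩ := hdone.of_writeDone.1
  refine ⟨Q, hQ, fun j hjQ hj m hnm => ?_⟩
  have hwts : (σ.proc q a).wts + 1 ≤ (σ.proc q b).wts := σ.wts_succ_le_of_invokeWrite hw ha hab
  have hsent : (σ.proc q b).acks j ≤ σ.progress j b / 2 := by
    rw [σ.acks_eq hw, ← (σ.entry_eq_and_countP_sent hw hj b).2.2]
    exact (σ.received_prefix_sent j q b).sublist.countP_le
  have hprog : σ.progress j b / 2 ≤ σ.progress j m / 2 :=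
    Nat.div_le_div_right (σ.progress_monotone j (by omega))
  rw [(σ.entry_eq_and_countP_sent hw hj m).1]
  exact hwts.trans ((hacks j hjQ).trans (hsent.trans hprog))

theorem rid_monotone (hp : p ∉ F) : Monotone fun n => (σ.proc p n).rid :=
  monotone_nat_of_le_succ fun n => (σ.localStep hp n).rid_le

theorem exists_reply_mem_inbox (hp : p ∉ F) (hn : ∀ k, (σ.proc p (n + 1)).readlist k = none)
    (hnm : n ≤ m) (hstep : ∀ l, n < l → l ≤ m → σ.step l ≠ .invokeRead p) :
    (σ.proc p (m + 1)).rid = (σ.proc p (n + 1)).rid ∧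
      ∀ k e, (σ.proc p (m + 1)).readlist k = some e →
        ∃ l ≤ m, e.reply (σ.proc p (n + 1)).rid ∈ σ.inbox p l k := by
  induction m, hnm using Nat.le_induction with
  | base => simp [hn]
  | succ m hnm ih =>
    obtain ⟨hrid, hreply⟩ := ih fun l hnl hlm => hstep l hnl (hlm.trans m.le_succ)
    have hcases := (σ.localStep hp (m + 1)).readlist_cases
    have hne := hstep (m + 1) (by omega) le_rfl
    refine ⟨(((hcases p).resolve_left fun h => hne h.1).1).trans hrid, fun k e he => ?_⟩
    obtain ⟨-, hsame | ⟨e', hmem, he'⟩⟩ := (hcases k).resolve_left fun h => hne h.1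
    · obtain ⟨l, hlm, hl⟩ := hreply k e (hsame ▸ he)
      exact ⟨l, hlm.trans m.le_succ, hl⟩
    · obtain rfl : e' = e := Option.some.inj (he'.symm.trans he)
      exact ⟨m + 1, le_rfl, hrid ▸ hmem⟩

theorem exists_entry_eq_of_reply_mem (hp : p ∉ F) (hk : k ∉ F) {e : Entry X}
    (hn : (σ.proc p n).rid < (σ.proc p (n + 1)).rid)
    (he : e.reply (σ.proc p (n + 1)).rid ∈ σ.inbox p m k) :
    ∃ l, n ≤ l ∧ l < m ∧ (σ.proc k l).entry = e := by
  obtain ⟨l, hlm, hl⟩ := σ.exists_mem_outbox_of_mem_inbox hk he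
  obtain ⟨hentry, hread⟩ := (σ.localStep hk l).entry_eq_of_reply_mem hl
  obtain ⟨l', hl'l, hl'⟩ := σ.exists_mem_outbox_of_mem_inbox hp hread
  have hrid := (σ.localStep hp l').rid_eq_of_read_mem hl'
  refine ⟨l, ?_, hlm, hentry⟩
  by_contra! hln
  have hle : (σ.proc p (l' + 1)).rid ≤ (σ.proc p n).rid := σ.rid_monotone hp (by omega)
  omega

theorem exists_selects_of_readCompletes (hp : p ∉ F) {x : X} (h : σ.history.ReadCompletes p n m x) :
    ∃ (t : ℕ) (readlist : P → Option (Entry X)), Selects 𝓕 𝓠 p readlist t x ∧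
      ∀ k ∉ F, ∀ e, readlist k = some e → ∃ l, n ≤ l ∧ l < m ∧ (σ.proc k l).entry = e := by
  obtain ⟨hn, hnm, hm, hnone⟩ := h
  obtain ⟨j, hret⟩ := σ.history_eq_readRet.1 hm
  have hinv := σ.localStep hp n
  rw [σ.history_eq_readInv.1 hn] at hinv
  obtain ⟨-, hrid, hlist, -⟩ := hinv.of_invokeRead
  have hsel := σ.localStep hp m
  rw [hret] at hsel
  obtain ⟨t, hsel⟩ := hsel.exists_selects
  have hread (l : ℕ) (hnl : n < l) (hlm : l ≤ m) : σ.step l ≠ .invokeRead p := fun hl => by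
    rcases hlm.lt_or_eq with hlm | rfl
    · exact hnone l hnl hlm _ (σ.history_eq_readInv.2 hl)
    · simp [hret] at hl
  refine ⟨t, _, hsel, fun k hk e he => ?_⟩
  obtain ⟨l, hlm, hl⟩ := (σ.exists_reply_mem_inbox hp hlist hnm.le hread).2 k e he
  obtain ⟨l', hnl', hl'l, hentry⟩ := σ.exists_entry_eq_of_reply_mem hp hk (by omega) hl
  exact ⟨l', hnl', hl'l.trans_le hlm, hentry⟩

theorem wts_lt_of_selects (h𝓠 : IsAsymQuorumSystem 𝓕 𝓠) (hw : w ∈ wise 𝓕 F) (hp : p ∈ wise 𝓕 F)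
    {readlist : P → Option (Entry X)} {t : ℕ} {x : X} (hsel : Selects 𝓕 𝓠 p readlist t x)
    (hlist : ∀ k ∉ F, ∀ e, readlist k = some e → ∃ l, n ≤ l ∧ (σ.proc k l).entry = e) {a : ℕ}
    (ha : σ.history.WritePrecedes a n) : (σ.proc w a).wts < t := by
  obtain ⟨Q, hQ, hQsel⟩ := hsel.2
  obtain ⟨Q', hQ', hts⟩ := σ.exists_quorum_le_ts_of_writePrecedes hw.1 ha
  obtain ⟨k, ⟨hkQ, hkQ'⟩, hk⟩ := h𝓠.exists_mem_inter_notMem hp hw hQ hQ'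
  obtain ⟨e, hke, he⟩ := hQsel hkQ
  obtain ⟨l, hnl, rfl⟩ := hlist k hk e hke
  have hwts := hts k hkQ' hk l hnl
  rcases he with he | he
  · omega
  · rw [(σ.entry_eq_and_countP_sent hw.1 hk l).1] at he hwts
    exact hwts.trans (carries_replicaEntry he).2.1

theorem val_eq_of_selects (hw : w ∉ F) (hp : p ∈ wise 𝓕 F)
    {readlist : P → Option (Entry X)} {t : ℕ} {x : X} (hsel : Selects 𝓕 𝓠 p readlist t x)
    (hlist : ∀ k ∉ F, ∀ e, readlist k = some e → ∃ l, l < m ∧ (σ.proc k l).entry = e) :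
    x = σ.val t ∧ t ≤ (σ.proc w m).wts := by
  obtain ⟨C, hC, hCsel⟩ := hsel.1
  obtain ⟨k, hkC, hk⟩ := exists_mem_coreSet_notMem hp hC
  obtain ⟨e, hke, he⟩ := hCsel hkC
  obtain ⟨l, hlm, rfl⟩ := hlist k hk e hke
  rw [(σ.entry_eq_and_countP_sent hw hk l).1] at he
  obtain ⟨hx, -, ht⟩ := carries_replicaEntry he
  have hprog := σ.progress_le_stage hw k l
  have hstage : (σ.proc w l).stage ≤ 2 * (σ.proc w l).wts := by
    unfold LocalState.stage
    split <;> omega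
  have hwts : (σ.proc w l).wts ≤ (σ.proc w m).wts := σ.wts_monotone hw hlm.le
  exact ⟨hx, by omega⟩

theorem safety (h𝓠 : IsAsymQuorumSystem 𝓕 𝓠) (hw : w ∈ wise 𝓕 F) (hp : p ∈ wise 𝓕 F) {x : X}
    (h : σ.history.ReadCompletes p n m x) :
    σ.history.LastWritten (wise 𝓕 F) x₀ n x ∨
      ∃ a, σ.history.IsWrite (wise 𝓕 F) a x ∧ σ.history.WriteConcurrent a n m := by
  obtain ⟨t, readlist, hsel, hlist⟩ := σ.exists_selects_of_readCompletes hp.1 h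
  have hlt {a : ℕ} (ha : σ.history.WritePrecedes a n) : (σ.proc w a).wts < t :=
    σ.wts_lt_of_selects h𝓠 hw hp hsel (fun k hk e he =>
      let ⟨l, hnl, _, hl⟩ := hlist k hk e he
      ⟨l, hnl, hl⟩) ha
  obtain ⟨rfl, htm⟩ := σ.val_eq_of_selects hw.1 hp hsel fun k hk e he =>
    let ⟨l, _, hlm, hl⟩ := hlist k hk e he
    ⟨l, hlm, hl⟩
  rcases t.eq_zero_or_pos with rfl | ht
  · exact .inl (.inr ⟨σ.val_zero, fun a _ _ ha => (hlt ha).not_ge (Nat.zero_le _)⟩)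
  obtain ⟨a, ham, ha, hat⟩ := σ.exists_invokeWrite hw.1 ht htm
  have hwrite : σ.history.IsWrite (wise 𝓕 F) a (σ.val t) :=
    ⟨w, hw, σ.history_eq_writeInv.2 ⟨rfl, ha⟩⟩
  by_cases hprec : σ.history.WritePrecedes a n
  · refine .inl (.inl ⟨a, hwrite, hprec, fun a' _ _ ha' => ?_⟩)
    by_contra! haa'
    have := σ.wts_succ_le_of_invokeWrite hw.1 ha haa'
    have := hlt ha'
    omega
  · exact .inr ⟨a, hwrite, hprec, ham.not_gt⟩

end Safety

section WriteLiveness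

variable {σ}

theorem wts_eq_of_phase_ne_idle (hw : w ∉ F) (hph : ∀ l, n ≤ l → (σ.proc w l).phase ≠ .idle)
    (hnm : n ≤ m) : (σ.proc w m).wts = (σ.proc w n).wts := by
  induction m, hnm using Nat.le_induction with
  | base => rfl
  | succ m hnm ih =>
    refine ((σ.localStep hw m).wts_eq fun x hx => ?_).trans ih
    have h := σ.localStep hw m
    rw [hx] at h
    exact hph m hnm h.of_invokeWrite.1

theorem Fair.exists_quorum_answers (hfair : σ.Fair) (h𝓠 : IsAsymQuorumSystem 𝓕 𝓠)
    (hw : w ∈ wise 𝓕 F) (hQfin : ∀ Q ∈ 𝓠 w, Q.Finite)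
    (hph : ∀ m, n ≤ m → (σ.proc w m).phase ≠ .idle) :
    ∃ Q ∈ 𝓠 w, ∃ N, n ≤ N ∧ ∀ m, N ≤ m → (σ.proc w m).wts = (σ.proc w n).wts ∧
      ∀ j ∈ Q, ((σ.proc w n).stage + 1) / 2 ≤ (σ.proc w m).preacks j ∧
        (σ.proc w n).stage / 2 ≤ (σ.proc w m).acks j := by
  obtain ⟨Q, hQ, hQF⟩ := h𝓠.exists_quorum_subset_compl hw
  have hans := (Filter.eventually_all_finite (hQfin Q hQ)).2 fun j hj =>
    (hfair.eventually_stage_le_preacks hw.1 (hQF hj) n).and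
      (hfair.eventually_stage_le_acks hw.1 (hQF hj) n)
  obtain ⟨N, hN⟩ := Filter.eventually_atTop.1 hans
  exact ⟨Q, hQ, max N n, le_max_right N n, fun m hm =>
    ⟨wts_eq_of_phase_ne_idle hw.1 hph (le_of_max_le_right hm), hN m (le_of_max_le_left hm)⟩⟩

theorem Fair.exists_phase_ne_prewriting (hfair : σ.Fair) (h𝓠 : IsAsymQuorumSystem 𝓕 𝓠)
    (hw : w ∈ wise 𝓕 F) (hQfin : ∀ Q ∈ 𝓠 w, Q.Finite) (n : ℕ) :
    ∃ m, n ≤ m ∧ ∀ x, (σ.proc w m).phase ≠ .prewriting x := by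
  by_contra! hph
  have hstage : (σ.proc w n).wts ≤ ((σ.proc w n).stage + 1) / 2 := by
    obtain ⟨x, hx⟩ := hph n le_rfl
    simp only [LocalState.stage, hx]
    omega
  obtain ⟨Q, hQ, N, hnN, hans⟩ := hfair.exists_quorum_answers h𝓠 hw hQfin fun m hm => by
    obtain ⟨x, hx⟩ := hph m hm
    simp [hx]
  have hquorum (m : ℕ) (hm : N ≤ m) : PreackQuorum 𝓠 w (σ.proc w m) :=
    ⟨hph m (hnN.trans hm), Q, hQ, fun j hj =>
      (hans m hm).1.trans_le (hstage.trans ((hans m hm).2 j hj).1)⟩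
  obtain ⟨m, hm, hdone⟩ := hfair.prewriteDone hw.1 _ hquorum
  have h := σ.localStep hw.1 m
  rw [hdone] at h
  obtain ⟨x, hx⟩ := h.of_prewriteDone
  obtain ⟨y, hy⟩ := hph (m + 1) (by omega)
  simp [hx] at hy

theorem Fair.exists_phase_ne_writing (hfair : σ.Fair) (h𝓠 : IsAsymQuorumSystem 𝓕 𝓠)
    (hw : w ∈ wise 𝓕 F) (hQfin : ∀ Q ∈ 𝓠 w, Q.Finite) (n : ℕ) :
    ∃ m, n ≤ m ∧ ∀ x, (σ.proc w m).phase ≠ .writing x := by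
  by_contra! hph
  have hstage : (σ.proc w n).wts ≤ (σ.proc w n).stage / 2 := by
    obtain ⟨x, hx⟩ := hph n le_rfl
    simp only [LocalState.stage, hx]
    omega
  obtain ⟨Q, hQ, N, hnN, hans⟩ := hfair.exists_quorum_answers h𝓠 hw hQfin fun m hm => by
    obtain ⟨x, hx⟩ := hph m hm
    simp [hx]
  have hquorum (m : ℕ) (hm : N ≤ m) : AckQuorum 𝓠 w (σ.proc w m) :=
    ⟨hph m (hnN.trans hm), Q, hQ, fun j hj =>
      (hans m hm).1.trans_le (hstage.trans ((hans m hm).2 j hj).2)⟩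
  obtain ⟨m, hm, hdone⟩ := hfair.writeDone hw.1 _ hquorum
  have h := σ.localStep hw.1 m
  rw [hdone] at h
  obtain ⟨x, hx⟩ := hph (m + 1) (by omega)
  simp [h.of_writeDone.2] at hx

theorem isWriting_of_event_ne (hp : p ∉ F) {x : X} (hs : (σ.proc p n).IsWriting x) (hnm : n ≤ m)
    (hno : ∀ l, n ≤ l → l < m → ∀ e, σ.history l ≠ some (p, e)) : (σ.proc p m).IsWriting x := by
  induction m, hnm using Nat.le_induction with
  | base => exact hs
  | succ m hnm ih =>
    exact (σ.localStep hp m).isWriting_of_event_ne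
      (ih fun l hnl hlm => hno l hnl (by omega)) (hno m hnm (by omega))

theorem Fair.exists_event_of_isWriting (hfair : σ.Fair) (h𝓠 : IsAsymQuorumSystem 𝓕 𝓠)
    (hw : w ∈ wise 𝓕 F) (hQfin : ∀ Q ∈ 𝓠 w, Q.Finite) {x : X}
    (hs : (σ.proc w n).IsWriting x) : ∃ m, n ≤ m ∧ ∃ e, σ.history m = some (w, e) := by
  by_contra! hno
  have hwriting {m : ℕ} (hnm : n ≤ m) : (σ.proc w m).IsWriting x :=
    isWriting_of_event_ne hw.1 hs hnm fun l hnl _ => hno l hnl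
  obtain ⟨m, hnm, hm⟩ := hfair.exists_phase_ne_prewriting h𝓠 hw hQfin n
  obtain ⟨m', hmm', hm'⟩ := hfair.exists_phase_ne_writing h𝓠 hw hQfin m
  refine hm' x ?_
  clear hm'
  induction m', hmm' using Nat.le_induction with
  | base => exact (hwriting hnm).resolve_left (hm x)
  | succ m' hmm' ih =>
    refine (σ.localStep hw.1 m').phase_eq_writing ih fun hdone => ?_
    exact hno m' (hnm.trans hmm') .writeAck (σ.history_eq_writeAck.2 ⟨rfl, hdone⟩)

theorem Fair.write_liveness (hfair : σ.Fair) (h𝓠 : IsAsymQuorumSystem 𝓕 𝓠)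
    (hw : w ∈ wise 𝓕 F) (hQfin : ∀ Q ∈ 𝓠 w, Q.Finite) {x : X}
    (hn : σ.history n = some (p, .writeInv x)) : ∃ m, σ.history.NextEvent p n m .writeAck := by
  obtain ⟨rfl, hn⟩ := σ.history_eq_writeInv.1 hn
  have hinv := σ.localStep hw.1 n
  rw [hn] at hinv
  have hwriting : (σ.proc p (n + 1)).IsWriting x := .inl hinv.of_invokeWrite.2.1
  obtain ⟨m, hnm, e, he⟩ := hfair.exists_event_of_isWriting h𝓠 hw hQfin hwriting
  obtain ⟨b, e', hnb, he', hno⟩ := History.exists_nextEvent hnm he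
  have hb := isWriting_of_event_ne hw.1 hwriting hnb hno
  obtain rfl := (σ.localStep hw.1 b).event_eq_writeAck hb he'
  exact ⟨b, hnb, he', hno⟩

end WriteLiveness

section ReadLiveness

variable {σ}

theorem exists_forall_step_ne_invokeWrite (hfin : σ.history.FinitelyManyWrites) :
    ∃ N, ∀ n, N ≤ n → ∀ x, σ.step n ≠ .invokeWrite x := by
  obtain ⟨N, hN⟩ := hfin.bddAbove
  refine ⟨N + 1, fun n hn x hx => ?_⟩
  have : n ≤ N := hN ⟨w, x, σ.history_eq_writeInv.2 ⟨rfl, hx⟩⟩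
  omega

theorem Fair.exists_forall_stage_eq (hfair : σ.Fair) (h𝓠 : IsAsymQuorumSystem 𝓕 𝓠)
    (hw : w ∈ wise 𝓕 F) (hQfin : ∀ Q ∈ 𝓠 w, Q.Finite) (hfin : σ.history.FinitelyManyWrites) :
    ∃ N t, ∀ n, N ≤ n → (σ.proc w n).stage = 2 * t := by
  obtain ⟨N₀, hN₀⟩ := exists_forall_step_ne_invokeWrite hfin
  obtain ⟨N, hN₀N, hN⟩ := hfair.exists_phase_ne_prewriting h𝓠 hw hQfin N₀
  refine ⟨N, (σ.proc w N).wts, fun n hn => ?_⟩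
  have hstable : (∀ x, (σ.proc w n).phase ≠ .prewriting x) ∧
      (σ.proc w n).wts = (σ.proc w N).wts := by
    induction n, hn using Nat.le_induction with
    | base => exact ⟨hN, rfl⟩
    | succ n hn ih =>
      have hne := hN₀ n (hN₀N.trans hn)
      have h := σ.localStep hw.1 n
      exact ⟨h.phase_ne_prewriting ih.1 hne, (h.wts_eq hne).trans ih.2⟩
  rw [← hstable.2, LocalState.stage]
  split
  · exact absurd ‹_› (hstable.1 _)
  · rfl

theorem Fair.exists_forall_eventually_entry_eq (hfair : σ.Fair) (h𝓠 : IsAsymQuorumSystem 𝓕 𝓠)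
    (hw : w ∈ wise 𝓕 F) (hQfin : ∀ Q ∈ 𝓠 w, Q.Finite) (hfin : σ.history.FinitelyManyWrites) :
    ∃ t, ∀ i ∉ F, ∀ᶠ n in Filter.atTop, (σ.proc i n).entry = replicaEntry σ.val (2 * t) := by
  obtain ⟨N, t, hN⟩ := hfair.exists_forall_stage_eq h𝓠 hw hQfin hfin
  refine ⟨t, fun i hi => ?_⟩
  filter_upwards [hfair.eventually_stage_le_progress hw.1 hi N, Filter.eventually_ge_atTop N]
    with n hn hNn
  have hle := σ.progress_le_stage hw.1 i n
  rw [hN n hNn] at hle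
  rw [hN N le_rfl] at hn
  rw [(σ.entry_eq_and_countP_sent hw.1 hi n).1, hle.antisymm hn]

theorem Fair.exists_reply_mem_inbox (hfair : σ.Fair) (hp : p ∉ F) (hk : k ∉ F) {r : ℕ}
    (hread : .read r ∈ σ.outbox p m k) :
    ∃ l, ∃ m' > m, (σ.proc k l).entry.reply r ∈ σ.inbox p m' k := by
  obtain ⟨l, hml, hl⟩ := hfair.exists_mem_inbox hp hk hread
  obtain ⟨m', hlm', hm'⟩ := hfair.exists_mem_inbox hk hp ((σ.localStep hk l).reply_mem hl)
  exact ⟨l, m', hml.trans hlm', hm'⟩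

theorem of_step_eq_invokeRead (hp : p ∉ F) (hn : σ.step n = .invokeRead p) :
    (σ.proc p (n + 1)).phase = .reading ∧
      ∀ k, .read (σ.proc p (n + 1)).rid ∈ σ.outbox p n k := by
  have hinv := σ.localStep hp n
  rw [hn] at hinv
  exact ⟨hinv.of_invokeRead.1, hinv.of_invokeRead.2.2.2⟩

theorem phase_eq_reading_of_event_ne (hp : p ∉ F) (hs : (σ.proc p n).phase = .reading)
    (hnm : n ≤ m) (hno : ∀ l, n ≤ l → l < m → ∀ e, σ.history l ≠ some (p, e)) :
    (σ.proc p m).phase = .reading ∧ (σ.proc p m).rid = (σ.proc p n).rid := by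
  induction m, hnm using Nat.le_induction with
  | base => exact ⟨hs, rfl⟩
  | succ m hnm ih =>
    obtain ⟨hph, hrid⟩ := ih fun l hnl hlm => hno l hnl (by omega)
    obtain ⟨hph', hrid'⟩ := (σ.localStep hp m).phase_eq_reading hph (hno m hnm (by omega))
    exact ⟨hph', hrid'.trans hrid⟩

/-- The read that `p` invokes in step `n` never completes. -/
def NeverReturns (σ : Execution 𝓕 𝓠 w x₀ F) (p : P) (n : ℕ) : Prop :=
  σ.step n = .invokeRead p ∧ ∀ m, n < m → ∀ e, σ.history m ≠ some (p, e)

namespace NeverReturns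

variable (h : σ.NeverReturns p n)
include h

theorem phase_eq_reading_and_rid_eq (hp : p ∉ F) (hnm : n < m) :
    (σ.proc p m).phase = .reading ∧ (σ.proc p m).rid = (σ.proc p (n + 1)).rid :=
  phase_eq_reading_of_event_ne hp (of_step_eq_invokeRead hp h.1).1 hnm fun l hnl _ => h.2 l hnl

theorem of_reply_mem (hw : w ∉ F) (hp : p ∉ F) (hnm : n < m) (hk : k ∉ F) {l : ℕ}
    (hl : (σ.proc k l).entry.reply (σ.proc p (n + 1)).rid ∈ σ.inbox p m k) :
    (σ.proc p (m + 1)).readlist k = some (σ.proc k l).entry ∧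
      (∀ t x, ¬ Selects 𝓕 𝓠 p (σ.proc p (m + 1)).readlist t x) ∧
      ∀ j, .read (σ.proc p (n + 1)).rid ∈ σ.outbox p m j := by
  obtain ⟨hph, hrid⟩ := h.phase_eq_reading_and_rid_eq hp hnm
  rw [← hrid] at hl ⊢
  refine (σ.localStep hp m).of_reply_mem hph (h.2 m hnm) hl ?_
  rw [(σ.entry_eq_and_countP_sent hw hk l).1]
  exact replicaEntry_wellFormed _ _

-- The reader also polls itself, and every answer makes it poll again.
theorem exists_read_mem_outbox (hfair : σ.Fair) (hw : w ∉ F) (hp : p ∉ F) (N : ℕ) :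
    ∃ m, n ≤ m ∧ N ≤ m ∧ ∀ j, .read (σ.proc p (n + 1)).rid ∈ σ.outbox p m j := by
  induction N with
  | zero => exact ⟨n, le_rfl, Nat.zero_le _, (of_step_eq_invokeRead hp h.1).2⟩
  | succ N ih =>
    obtain ⟨m, hnm, hNm, hread⟩ := ih
    obtain ⟨l, m', hmm', hl⟩ := hfair.exists_reply_mem_inbox hp hp (hread p)
    exact ⟨m', by omega, by omega, (h.of_reply_mem hw hp (by omega) hp hl).2.2⟩

theorem exists_reply_mem_inbox (hfair : σ.Fair) (hw : w ∉ F) (hp : p ∉ F) (hk : k ∉ F) (N : ℕ) :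
    ∃ m, N ≤ m ∧ n < m ∧
      ∃ l, (σ.proc k l).entry.reply (σ.proc p (n + 1)).rid ∈ σ.inbox p m k := by
  obtain ⟨m, hnm, hNm, hread⟩ := h.exists_read_mem_outbox hfair hw hp N
  obtain ⟨l, m', hmm', hl⟩ := hfair.exists_reply_mem_inbox hp hk (hread k)
  exact ⟨m', by omega, by omega, l, hl⟩

theorem eventually_readlist_eq (hfair : σ.Fair) (hw : w ∉ F) (hp : p ∉ F) (hk : k ∉ F)
    {e : Entry X} (he : ∀ᶠ m in Filter.atTop, (σ.proc k m).entry = e) :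
    ∀ᶠ m in Filter.atTop, (σ.proc p m).readlist k = some e := by
  obtain ⟨N, hN⟩ := Filter.eventually_atTop.1 he
  obtain ⟨M, hM⟩ := Filter.eventually_atTop.1 (hfair.eventually_inbox_subset hk hp N)
  have hfresh {m r : ℕ} {e' : Entry X} (hMm : M ≤ m) (he' : e'.reply r ∈ σ.inbox p m k) :
      e' = e := by
    obtain ⟨l, hNl, -, hl⟩ := hM m hMm _ he'
    exact ((σ.localStep hk l).entry_eq_of_reply_mem hl).1.symm.trans (hN l hNl)
  obtain ⟨m₀, hMm₀, hnm₀, l, hl⟩ := h.exists_reply_mem_inbox hfair hw hp hk M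
  filter_upwards [Filter.eventually_gt_atTop m₀] with m hm₀m
  induction m, hm₀m using Nat.le_induction with
  | base => exact (h.of_reply_mem hw hp hnm₀ hk hl).1.trans (congrArg some (hfresh hMm₀ hl))
  | succ m hm₀m ih =>
    rcases (σ.localStep hp m).readlist_cases k with ⟨hinv, -⟩ | ⟨-, hsame | ⟨e', he', hm⟩⟩
    · exact absurd (σ.history_eq_readInv.2 hinv) (h.2 m (by omega) _)
    · exact hsame.trans ih
    · exact hm.trans (congrArg some (hfresh (by omega) he'))

end NeverReturns

theorem Fair.not_neverReturns (hfair : σ.Fair) (h𝓠 : IsAsymQuorumSystem 𝓕 𝓠)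
    (hQfin : ∀ i, ∀ Q ∈ 𝓠 i, Q.Finite) (hw : w ∈ wise 𝓕 F) (hp : p ∈ wise 𝓕 F)
    (hfin : σ.history.FinitelyManyWrites) : ¬ σ.NeverReturns p n := by
  intro h
  obtain ⟨t, ht⟩ := hfair.exists_forall_eventually_entry_eq h𝓠 hw (hQfin w) hfin
  obtain ⟨Q, hQ, hQF⟩ := h𝓠.exists_quorum_subset_compl hp
  have hlist : ∀ᶠ m in Filter.atTop, ∀ k ∈ Q,
      (σ.proc p m).readlist k = some (replicaEntry σ.val (2 * t)) :=
    (Filter.eventually_all_finite (hQfin p Q hQ)).2 fun k hk =>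
      h.eventually_readlist_eq hfair hw.1 hp.1 (hQF hk) (ht k (hQF hk))
  obtain ⟨N, hN⟩ := Filter.eventually_atTop.1 hlist
  obtain ⟨m, hNm, hnm, l, hl⟩ := h.exists_reply_mem_inbox hfair hw.1 hp.1 hp.1 N
  exact (h.of_reply_mem hw.1 hp.1 hnm hp.1 hl).2.1 _ _
    (h𝓠.selects_of_forall_mem_quorum hQ (hQfin p Q hQ) (hN (m + 1) (by omega)))

theorem Fair.read_liveness (hfair : σ.Fair) (h𝓠 : IsAsymQuorumSystem 𝓕 𝓠)
    (hQfin : ∀ i, ∀ Q ∈ 𝓠 i, Q.Finite) (hw : w ∈ wise 𝓕 F) (hp : p ∈ wise 𝓕 F)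
    (hfin : σ.history.FinitelyManyWrites) (hn : σ.history n = some (p, .readInv)) :
    ∃ m x, σ.history.NextEvent p n m (.readRet x) := by
  have hstep := σ.history_eq_readInv.1 hn
  have hevent : ∃ m, n < m ∧ ∃ e, σ.history m = some (p, e) := by
    by_contra! hno
    exact hfair.not_neverReturns h𝓠 hQfin hw hp hfin ⟨hstep, hno⟩
  obtain ⟨m, hnm, e, he⟩ := hevent
  obtain ⟨b, e', hnb, he', hno⟩ := History.exists_nextEvent hnm he
  have hb := phase_eq_reading_of_event_ne hp.1 (of_step_eq_invokeRead hp.1 hstep).1 hnb hno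
  obtain ⟨x, rfl⟩ := (σ.localStep hp.1 b).event_eq_readRet hb.1 he'
  exact ⟨b, x, hnb, he', hno⟩

end ReadLiveness
end Execution
end AsymRegister

theorem mainTheorem3_general {P X : Type*} [DecidableEq P]
    (𝓕 𝓠 : P → Set (Set P)) (h𝓠 : AsymRegister.IsAsymQuorumSystem 𝓕 𝓠)
    (hQfin : ∀ i, ∀ Q ∈ 𝓠 i, Q.Finite)
    (w : P) (x₀ : X) (F : Set P) (hw : w ∈ AsymRegister.wise 𝓕 F)
    (σ : AsymRegister.Execution 𝓕 𝓠 w x₀ F) (hfair : σ.Fair)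
    (hfin : σ.history.FinitelyManyWrites) :
    σ.history.IsRegularRegister (AsymRegister.wise 𝓕 F) x₀ where
  write_liveness _ _ _ _ hn := hfair.write_liveness h𝓠 hw (hQfin w) hn
  read_liveness _ hp _ hn := hfair.read_liveness h𝓠 hQfin hw hp hfin hn
  safety _ hp _ _ _ h := σ.safety h𝓠 hw hp h

theorem mainTheorem3 {P X : Type*} [Finite P] [DecidableEq P]
    (𝓕 : P → Set (Set P)) (h𝓕 : ∀ i, AsymRegister.IsFailProneSystem (𝓕 i))
    (𝓠 : P → Set (Set P)) (h𝓠 : AsymRegister.IsAsymQuorumSystem 𝓕 𝓠)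
    (w : P) (x₀ : X) (F : Set P) (hw : w ∈ AsymRegister.wise 𝓕 F)
    (σ : AsymRegister.Execution 𝓕 𝓠 w x₀ F) (hfair : σ.Fair)
    (hfin : σ.history.FinitelyManyWrites) :
    σ.history.IsRegularRegister (AsymRegister.wise 𝓕 F) x₀ :=
  mainTheorem3_general 𝓕 𝓠 h𝓠 (fun _ Q _ => Q.toFinite) w x₀ F hw σ hfair hfin
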